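/- Let $I\subset\mathbb R$ be an interval and let $(\Omega_\varepsilon)_{\varepsilon\in I}$ be an analytic family of strictly convex bounded analytic domains in $\mathbb R^2$: for each $\varepsilon\in I$ the boundary $\partial\Omega_\varepsilon$ is parametrized by a regular simple closed curve $t\mapsto\gamma_\varepsilon(t)$ of period $1$, and $(\varepsilon,t)\mapsto\gamma_\varepsilon(t)$ is real-analytic on $I\times\mathbb R$. For $\varepsilon\in I$ write $\gamma=\gamma_\varepsilon$ and $\omega=dx\wedge dy$. For $t\in\mathbb R$ let $t^*\in(t,t+1)$ be the unique parameter at which the tangent line to the boundary is parallel to that at $t$, and let $\mathcal P=\{(t_1,t_2)\in\mathbb R^2 : t_1<t_2<t_1^*\}$. The symplectic billiard map of $\Omega_\varepsilon$ is the map $\mathcal P\to\mathcal P$, $(t_1,t_2)\mapsto(t_2,t_3)$, where $t_3$ is determined by the requirement that the line through $\gamma(t_1)$ and $\gamma(t_3)$ be parallel to the tangent line at $\gamma(t_2)$. In the coordinates $(t,s)$ given by $t=t_1$, $s=\omega(\gamma'(t_1),\gamma(t_2))$ it becomes a map $F_\varepsilon$ of an open strip $\mathbb A_\varepsilon\subset\mathbb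 R^2$ to itself. For coprime $m\in\mathbb Z$, $n\in\mathbb N^*$, the symplectic billiard map of $\Omega_\varepsilon$ has an $(m,n)$-periodic invariant curve if there is a $1$-periodic Lipschitz function $g:\mathbb R\to\mathbb R$ whose graph $\Gamma$ lies in $\mathbb A_\varepsilon$ and satisfies $F_\varepsilon(\Gamma)\subseteq\Gamma$ and $F_\varepsilon^n(t,g(t))=(t+m,g(t))$ for all $t\in\mathbb R$. Let $(m,n)\in\mathbb Z\times\mathbb N^*$ be coprime with $m/n\in(0,1)$. Then the set of $\varepsilon\in I$ for which the symplectic billiard map of $\Omega_\varepsilon$ has an $(m,n)$-periodic invariant curve either has no accumulation point in $I$ or is all of $I$. In particular, if $I$ is compact, this set is either finite or all of $I$. -/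

import Mathlib

open Set Filter Topology

namespace SymplecticBilliard

/-- The Euclidean plane. -/
abbrev Plane : Type := EuclideanSpace ℝ (Fin 2)

/-- The canonical symplectic (area) form `dx ∧ dy` of the plane. -/
def area (u v : Plane) : ℝ := u 0 * v 1 - u 1 * v 0

/-- `Ω` is a strictly convex bounded domain of the plane. (For an open set, strict convexity is a
condition on the closure: the boundary contains no nondegenerate segment.) -/
structure IsStrictlyConvexDomain (Ω : Set Plane) : Prop where
  isOpen : IsOpen Ω
  nonempty : Ω.Nonempty
  isBounded : Bornology.IsBounded Ω
  convex : Convex ℝ Ω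
  strictConvex_closure : StrictConvex ℝ (closure Ω)

/-- `γ` is a regular simple closed parametrization, of period `1`, of the boundary of `Ω`. -/
structure IsBoundaryParametrization (Ω : Set Plane) (γ : ℝ → Plane) : Prop where
  differentiable : Differentiable ℝ γ
  periodic : Function.Periodic γ 1
  injOn : Set.InjOn γ (Set.Ico 0 1)
  deriv_ne_zero : ∀ t, deriv γ t ≠ 0
  range_eq : Set.range γ = frontier Ω

/-- `(Ω ε)`, for `ε ∈ I`, is an analytic family of strictly convex analytic domains: the boundaries
are parametrized by curves `γ ε` such that `(ε, t) ↦ γ ε t` is real-analytic on `I × ℝ`. -/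
structure IsAnalyticFamily (I : Set ℝ) (Ω : ℝ → Set Plane) (γ : ℝ → ℝ → Plane) : Prop where
  domain : ∀ ε ∈ I, IsStrictlyConvexDomain (Ω ε)
  param : ∀ ε ∈ I, IsBoundaryParametrization (Ω ε) (γ ε)
  analytic : AnalyticOn ℝ (fun x : ℝ × ℝ => γ x.1 x.2) (I ×ˢ Set.univ)

/-- The phase space of pairs `(t₁, t₂)` with `t₁ < t₂ < t₁*`, where `t₁*` is the (unique) parameter
in `(t₁, t₁ + 1)` at which the tangent line is parallel to the tangent line at `t₁`. -/
def phaseSpace (γ : ℝ → Plane) : Set (ℝ × ℝ) :=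
  {x | ∃ tstar ∈ Set.Ioo x.1 (x.1 + 1),
    area (deriv γ x.1) (deriv γ tstar) = 0 ∧ x.1 < x.2 ∧ x.2 < tstar}

/-- The reflection law: `γ t₁`, `γ t₂`, `γ t₃` are successive impact points, i.e. the line through
`γ t₁` and `γ t₃` is parallel to the tangent line at `γ t₂`. -/
def IsBounce (γ : ℝ → Plane) (t₁ t₂ t₃ : ℝ) : Prop :=
  (t₁, t₂) ∈ phaseSpace γ ∧ (t₂, t₃) ∈ phaseSpace γ ∧
    area (deriv γ t₂) (γ t₃ - γ t₁) = 0

/-- The symplectic billiard map `(t₁, t₂) ↦ (t₂, t₃)` on the phase space (for a strictly convex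
domain `t₃` exists and is unique). Values outside the phase space are irrelevant. -/
noncomputable def billiardMap (γ : ℝ → Plane) (x : ℝ × ℝ) : ℝ × ℝ :=
  (x.2, Classical.epsilon fun t₃ => IsBounce γ x.1 x.2 t₃)

/-- The change of coordinates `(t₁, t₂) ↦ (t₁, s₁)`, `s₁ = ω(γ'(t₁), γ(t₂))`, where `s₁` is the
variable conjugate to `t₁`. It is injective on the phase space. -/
noncomputable def coord (γ : ℝ → Plane) (x : ℝ × ℝ) : ℝ × ℝ :=
  (x.1, area (deriv γ x.1) (γ x.2))

/-- The open strip of the pairs `(t, s)` that correspond to points of the phase space. -/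
def strip (γ : ℝ → Plane) : Set (ℝ × ℝ) := coord γ '' phaseSpace γ

/-- The symplectic billiard map in the coordinates `(t, s)`: the twist map of the strip. -/
noncomputable def twistMap (γ : ℝ → Plane) (y : ℝ × ℝ) : ℝ × ℝ :=
  coord γ (billiardMap γ (Function.invFunOn (coord γ) (phaseSpace γ) y))

/-- The symplectic billiard map has an `(m, n)`-periodic invariant curve: the graph, inside the
strip, of a Lipschitz continuous `1`-periodic function `g`, which is invariant and on which the
`n`-th iterate of the map is the translation by `(m, 0)`. -/
def HasPeriodicInvariantCurve (γ : ℝ → Plane) (m : ℤ) (n : ℕ) : Prop :=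
  ∃ g : ℝ → ℝ, (∃ K, LipschitzWith K g) ∧ Function.Periodic g 1 ∧
    (∀ t, (t, g t) ∈ strip γ) ∧
    (∀ t, ∃ t', twistMap γ (t, g t) = (t', g t')) ∧
    (∀ t, (twistMap γ)^[n] (t, g t) = (t + m, g t))

end SymplecticBilliard

namespace SymplecticBilliard

/-! ### Ovals -/

/-! An invariant curve is encoded by a circle lift `f` for which `t, f t, f (f t)` are successive
impacts and `f^[n] t = t + m` (`IsResonant`). Let resonant parameters accumulate at `ε₀` and fix an
ultrafilter of such parameters converging to `ε₀`. By compactness the orbit of each `t` converges.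
The limit is a genuine orbit: a limit on the boundary of the phase space would have rotation number
`0` or `1/2`, while `0 < m` and the resonant curves themselves force `2 * m < n`
(`IsResonant.two_mul_lt`).

The decisive point is a nondegeneracy of the limit orbit. Two neighbouring orbits on the same curve
stay ordered, so their normalized differences converge to a Jacobi field that is positive everywhere
(`exists_pos_jacobi`). A positive solution makes the Jacobi equation disconjugate
(`jacobi_eq_zero`), so the problem with fixed endpoints has an invertible linearization. The
analytic inverse function theorem then presents the orbit segments from `t` to `t + m` as an
analytic graph over `(ε, t)` (`exists_segment_graph`), and the resonant lifts have to lie on it.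
Hence they are the restrictions of one analytic function `f (ε, t)` near `ε₀`
(`exists_analytic_lift`). No Lipschitz bound uniform in `ε` enters.

The equations of a resonant lift are analytic in `ε` and hold for parameters accumulating at `ε₀`,
hence on a ball around it; the strict inequalities survive near `ε₀` by compactness. So resonance
persists locally (`eventually_hasPeriodicInvariantCurve`), and connectedness of `I` spreads it. An
endpoint of `I` is unfolded to an interior parameter by `ε = β ± δ ^ 2`. -/

lemma area_swap (u v : Plane) : area u v = -area v u := by
  simp only [area]; ring

lemma area_sub (u v w : Plane) : area u (v - w) = area u v - area u w := by
  simp only [area, PiLp.sub_apply]; ring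

lemma area_zero_left (v : Plane) : area 0 v = 0 := by simp [area]

lemma area_zero_right (v : Plane) : area v 0 = 0 := by simp [area]

lemma smul_area (c : ℝ) (v w : Plane) : area (c • v) w = c * area v w := by
  simp only [area, PiLp.smul_apply, smul_eq_mul]; ring

lemma exists_smul_eq_of_area_eq_zero {u v : Plane} (hu : u ≠ 0) (h : area u v = 0) :
    ∃ c : ℝ, v = c • u := by
  have hs : u 0 ^ 2 + u 1 ^ 2 ≠ 0 := by
    intro h0
    apply hu
    have h1 : u 0 = 0 := by nlinarith [sq_nonneg (u 0), sq_nonneg (u 1)]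
    have h2 : u 1 = 0 := by nlinarith [sq_nonneg (u 0), sq_nonneg (u 1)]
    ext i
    fin_cases i
    · simpa using h1
    · simpa using h2
  refine ⟨(u 0 * v 0 + u 1 * v 1) / (u 0 ^ 2 + u 1 ^ 2), ?_⟩
  simp only [area] at h
  ext i
  fin_cases i
  · simp only [PiLp.smul_apply, smul_eq_mul]
    field_simp
    simp only [Fin.zero_eta, Fin.isValue]
    linear_combination (-u 1) * h
  · simp only [PiLp.smul_apply, smul_eq_mul]
    field_simp
    simp only [Fin.mk_one, Fin.isValue]
    linear_combination (u 0) * h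

/-- The linear form `area v`. -/
noncomputable def areaCLM (v : Plane) : Plane →L[ℝ] ℝ :=
  v 0 • EuclideanSpace.proj 1 - v 1 • EuclideanSpace.proj 0

lemma areaCLM_apply (v w : Plane) : areaCLM v w = area v w := by
  simp [areaCLM, area]

lemma hasDerivAt_area_right (v : Plane) {c : ℝ → Plane} {c' : Plane} {t : ℝ}
    (h : HasDerivAt c c' t) : HasDerivAt (fun u => area v (c u)) (area v c') t := by
  have := (areaCLM v).hasFDerivAt.comp_hasDerivAt t h
  simpa only [Function.comp_def, areaCLM_apply] using this

lemma continuous_area : Continuous fun p : Plane × Plane => area p.1 p.2 := by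
  unfold area; fun_prop

/-- A regular, closed, `1`-periodic `C¹` curve lying strictly on one side (given by the sign of
`σ`) of each of its tangent lines. -/
structure IsOval (γ : ℝ → Plane) (σ : ℝ) : Prop where
  differentiable : Differentiable ℝ γ
  continuous_deriv : Continuous (deriv γ)
  periodic : Function.Periodic γ 1
  pos : ∀ t u, t < u → u < t + 1 → 0 < σ * area (deriv γ t) (γ u - γ t)

/-- Hahn–Banach gives a functional `ℓ` supporting `Ω` at `γ t`. As `ℓ ∘ γ` is maximal at `t`, it
kills `deriv γ t`, so `ℓ` is a multiple of `area (deriv γ t)`. -/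
lemma exists_area_eq_of_supporting {Ω : Set Plane} {γ : ℝ → Plane}
    (hΩ : IsStrictlyConvexDomain Ω) (hγ : IsBoundaryParametrization Ω γ) (t : ℝ) :
    ∃ c : ℝ, (∀ x ∈ Ω, c * area (deriv γ t) x < c * area (deriv γ t) (γ t)) := by
  have hmem : γ t ∈ frontier Ω := hγ.range_eq ▸ mem_range_self t
  have hnot : γ t ∉ Ω := fun h => by
    rw [hΩ.isOpen.frontier_eq] at hmem
    exact hmem.2 h
  obtain ⟨ℓ, hℓ⟩ := geometric_hahn_banach_open_point hΩ.convex hΩ.isOpen hnot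
  have hcl : ∀ x ∈ closure Ω, ℓ x ≤ ℓ (γ t) := fun x hx =>
    closure_minimal (fun y hy => (hℓ y hy).le) (isClosed_le ℓ.continuous continuous_const) hx
  have hd : HasDerivAt (fun u => ℓ (γ u)) (ℓ (deriv γ t)) t :=
    ℓ.hasFDerivAt.comp_hasDerivAt t (hγ.differentiable t).hasDerivAt
  have hmax : IsLocalMax (fun u => ℓ (γ u)) t := Eventually.of_forall fun u =>
    hcl _ (frontier_subset_closure (hγ.range_eq ▸ mem_range_self u))
  have h0 : ℓ (deriv γ t) = 0 := hmax.hasDerivAt_eq_zero hd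
  set e0 : Plane := EuclideanSpace.single 0 1
  set e1 : Plane := EuclideanSpace.single 1 1
  have hrep : ∀ v : Plane, ℓ v = v 0 * ℓ e0 + v 1 * ℓ e1 := by
    intro v
    have : v = v 0 • e0 + v 1 • e1 := by
      ext i
      fin_cases i <;> simp [e0, e1]
    conv_lhs => rw [this]
    simp
  rw [hrep] at h0
  -- This vector represents `ℓ` through `area`: pairing it with `v` on the left gives `ℓ v`. So `ℓ
  -- (deriv γ t) = 0` means that it is parallel to the tangent.
  have hperp : area (deriv γ t) (!₂[-ℓ e1, ℓ e0] : Plane) = 0 := by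
    simp only [area]; simp; linarith
  obtain ⟨c, hc⟩ := exists_smul_eq_of_area_eq_zero (hγ.deriv_ne_zero t) hperp
  have hc0 := congrArg (fun v : Plane => v 0) hc
  have hc1 := congrArg (fun v : Plane => v 1) hc
  simp at hc0 hc1
  have key : ∀ v : Plane, ℓ v = -c * area (deriv γ t) v := by
    intro v
    have h1 : ℓ e1 = -(c * deriv γ t 0) := by linarith
    rw [hrep, area, h1, hc1]
    ring
  exact ⟨-c, fun x hx => by rw [← key, ← key]; exact hℓ x hx⟩

/-- Otherwise the midpoint of the chord lies in `Ω` by strict convexity, and also on the supporting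
line at `γ t`, which misses `Ω`. -/
lemma eq_of_area_eq_zero {Ω : Set Plane} {γ : ℝ → Plane}
    (hΩ : IsStrictlyConvexDomain Ω) (hγ : IsBoundaryParametrization Ω γ) {t u : ℝ}
    (h : area (deriv γ t) (γ u - γ t) = 0) : γ u = γ t := by
  by_contra hne
  obtain ⟨c, hc⟩ := exists_area_eq_of_supporting hΩ hγ t
  have hcl : ∀ v, γ v ∈ closure Ω := fun v =>
    frontier_subset_closure (hγ.range_eq ▸ mem_range_self v)
  have hmid := hΩ.strictConvex_closure (hcl u) (hcl t) hne (a := 1 / 2) (b := 1 / 2)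
    (by norm_num) (by norm_num) (by norm_num)
  have hint : interior (closure Ω) = Ω := by
    rw [hΩ.convex.interior_closure_eq_interior_of_nonempty_interior
      (by rw [hΩ.isOpen.interior_eq]; exact hΩ.nonempty), hΩ.isOpen.interior_eq]
  rw [hint] at hmid
  have := hc _ hmid
  rw [area_sub] at h
  have hlin : area (deriv γ t) ((1 / 2 : ℝ) • γ u + (1 / 2 : ℝ) • γ t)
      = 1 / 2 * area (deriv γ t) (γ u) + 1 / 2 * area (deriv γ t) (γ t) := by
    simp only [area, PiLp.add_apply, PiLp.smul_apply, smul_eq_mul]; ring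
  rw [hlin] at this
  have h' : area (deriv γ t) (γ u) = area (deriv γ t) (γ t) := by linarith
  rw [h'] at this
  linarith

lemma IsBoundaryParametrization.ne_of_lt {Ω : Set Plane} {γ : ℝ → Plane}
    (hγ : IsBoundaryParametrization Ω γ) {t u : ℝ} (h1 : t < u) (h2 : u < t + 1) :
    γ u ≠ γ t := by
  intro h
  have hfr : ∀ v, γ v = γ (Int.fract v) := fun v => by
    have := hγ.periodic.sub_int_mul_eq (x := v) ⌊v⌋
    rw [mul_one] at this
    exact this.symm
  rw [hfr u, hfr t] at h
  have := hγ.injOn ⟨Int.fract_nonneg u, Int.fract_lt_one u⟩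
    ⟨Int.fract_nonneg t, Int.fract_lt_one t⟩ h
  obtain ⟨z, hz⟩ := Int.fract_eq_fract.1 this
  have hz0 : (0 : ℝ) < z := by linarith
  have hz1 : (z : ℝ) < 1 := by linarith
  have : 0 < z := by exact_mod_cast hz0
  have : z < 1 := by exact_mod_cast hz1
  omega

/-- The height of `γ u` above the tangent at `t` has no zero on the convex strip `t < u < t + 1`,
hence a constant sign there; its value at `(0, 1/2)` serves as `σ`. -/
theorem exists_isOval {Ω : Set Plane} {γ : ℝ → Plane} (hΩ : IsStrictlyConvexDomain Ω)
    (hγ : IsBoundaryParametrization Ω γ) (hc : Continuous (deriv γ)) :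
    ∃ σ, IsOval γ σ := by
  set H : ℝ × ℝ → ℝ := fun p => area (deriv γ p.1) (γ p.2 - γ p.1)
  set D : Set (ℝ × ℝ) := {p | p.1 < p.2 ∧ p.2 < p.1 + 1}
  have hD : IsPreconnected D := by
    apply Convex.isPreconnected
    rintro ⟨a, b⟩ ⟨h1, h2⟩ ⟨a', b'⟩ ⟨h1', h2'⟩ x y hx hy hxy
    simp only at h1 h2 h1' h2'
    constructor
    · simp only [Prod.smul_mk, Prod.mk_add_mk, smul_eq_mul]
      rcases hx.eq_or_lt with rfl | hx
      · have : y = 1 := by linarith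
        subst this; linarith
      · nlinarith
    · simp only [Prod.smul_mk, Prod.mk_add_mk, smul_eq_mul]
      rcases hx.eq_or_lt with rfl | hx
      · have : y = 1 := by linarith
        subst this; linarith
      · nlinarith
  have hγc : Continuous γ := hγ.differentiable.continuous
  have hH : Continuous H := continuous_area.comp
    ((hc.comp continuous_fst).prodMk ((hγc.comp continuous_snd).sub (hγc.comp continuous_fst)))
  have hne : ∀ p ∈ D, H p ≠ 0 := fun p hp h =>
    hγ.ne_of_lt hp.1 hp.2 (eq_of_area_eq_zero hΩ hγ h)
  have h0 : ((0 : ℝ), (1 / 2 : ℝ)) ∈ D := by constructor <;> norm_num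
  refine ⟨H (0, 1 / 2), hγ.differentiable, hc, hγ.periodic, fun t u h1 h2 => ?_⟩
  have hp : (t, u) ∈ D := ⟨h1, h2⟩
  change 0 < H (0, 1 / 2) * H (t, u)
  by_contra hcon
  push Not at hcon
  rcases lt_or_gt_of_ne (hne _ h0) with ha | ha
  · have hb : 0 ≤ H (t, u) := by
      by_contra hb
      push Not at hb
      nlinarith
    obtain ⟨q, hq, hq0⟩ := hD.intermediate_value h0 hp hH.continuousOn ⟨ha.le, hb⟩
    exact hne q hq hq0
  · have hb : H (t, u) ≤ 0 := by
      by_contra hb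
      push Not at hb
      nlinarith
    obtain ⟨q, hq, hq0⟩ := hD.intermediate_value hp h0 hH.continuousOn ⟨hb, ha.le⟩
    exact hne q hq hq0

namespace IsOval

variable {γ : ℝ → Plane} {σ : ℝ}

lemma continuous (h : IsOval γ σ) : Continuous γ := h.differentiable.continuous

lemma ne_zero (h : IsOval γ σ) : σ ≠ 0 := by
  rintro rfl
  simpa using h.pos 0 (1 / 2) (by norm_num) (by norm_num)

lemma deriv_ne_zero (h : IsOval γ σ) (t : ℝ) : deriv γ t ≠ 0 := by
  intro h0
  have := h.pos t (t + 1 / 2) (by linarith) (by linarith)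
  rw [h0, area_zero_left] at this
  simp at this

lemma deriv_periodic (h : IsOval γ σ) : Function.Periodic (deriv γ) 1 := fun t => by
  rw [← deriv_comp_add_const]
  congr 1
  exact funext h.periodic

lemma add_int (h : IsOval γ σ) (t : ℝ) (k : ℤ) : γ (t + k) = γ t := by
  simpa using h.periodic.int_mul k t

lemma deriv_add_int (h : IsOval γ σ) (t : ℝ) (k : ℤ) : deriv γ (t + k) = deriv γ t := by
  simpa using h.deriv_periodic.int_mul k t

lemma lt_area (h : IsOval γ σ) {t u : ℝ} (h1 : t < u) (h2 : u < t + 1) :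
    σ * area (deriv γ t) (γ t) < σ * area (deriv γ t) (γ u) := by
  have := h.pos t u h1 h2
  rw [area_sub, mul_sub] at this
  linarith

lemma hasDerivAt_area (h : IsOval γ σ) (v : Plane) (u : ℝ) :
    HasDerivAt (fun u => area v (γ u)) (area v (deriv γ u)) u :=
  hasDerivAt_area_right v (h.differentiable u).hasDerivAt

end IsOval

/-- `τ` is the parameter in `(t, t + 1)` of a point whose tangent line is parallel to that
at `t`. -/
def IsStar (γ : ℝ → Plane) (t τ : ℝ) : Prop :=
  τ ∈ Ioo t (t + 1) ∧ area (deriv γ t) (deriv γ τ) = 0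

/-- The parameter in `(t, t + 1)` of the point whose tangent line is parallel to that at `t`. -/
noncomputable def star (γ : ℝ → Plane) (t : ℝ) : ℝ := Classical.epsilon (IsStar γ t)

/-! ### Parallel tangents and heights above a tangent line. -/

namespace IsOval

variable {γ : ℝ → Plane} {σ : ℝ}

lemma exists_isStar (h : IsOval γ σ) (t : ℝ) : ∃ τ, IsStar γ t τ := by
  obtain ⟨τ, hτ, h0⟩ := exists_hasDerivAt_eq_zero (f := fun u => area (deriv γ t) (γ u))
    (f' := fun u => area (deriv γ t) (deriv γ u)) (a := t) (b := t + 1) (by linarith)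
    (fun u _ => (h.hasDerivAt_area _ u).continuousAt.continuousWithinAt)
    (by simp only [h.periodic t]) (fun u _ => h.hasDerivAt_area _ u)
  exact ⟨τ, hτ, h0⟩

/-- At a point with tangent parallel to that at `t`, comparison with `γ t` shows that the tangent is
reversed (`c < 0`). The one-sidedness condition then makes the height there larger than at every
other point. Two such points would each be strictly higher than the other. -/
lemma isStar_unique_aux (h : IsOval γ σ) {t a b : ℝ} (ha : IsStar γ t a) (hb : IsStar γ t b)
    (hab : a < b) : False := by
  obtain ⟨⟨ha1, ha2⟩, ha3⟩ := ha
  obtain ⟨⟨hb1, hb2⟩, hb3⟩ := hb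
  obtain ⟨c, hc⟩ := exists_smul_eq_of_area_eq_zero (h.deriv_ne_zero t) ha3
  obtain ⟨d, hd⟩ := exists_smul_eq_of_area_eq_zero (h.deriv_ne_zero t) hb3
  have e1 := h.lt_area ha1 ha2
  have e2 := h.lt_area hb1 hb2
  have e3 := h.lt_area (t := a) (u := t + 1) ha2 (by linarith)
  have e4 := h.lt_area (t := a) (u := b) hab (by linarith)
  have e5 := h.lt_area (t := b) (u := t + 1) hb2 (by linarith)
  have e6 := h.lt_area (t := b) (u := a + 1) (by linarith) (by linarith)
  rw [hc, smul_area, smul_area] at e3 e4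
  rw [hd, smul_area, smul_area] at e5 e6
  rw [h.periodic] at e3 e5 e6
  set x := area (deriv γ t) (γ a)
  set y := area (deriv γ t) (γ b)
  set z := area (deriv γ t) (γ t)
  have hc' : c < 0 := by nlinarith
  have hd' : d < 0 := by nlinarith
  have : σ * y < σ * x := by nlinarith
  nlinarith

lemma isStar_unique (h : IsOval γ σ) {t a b : ℝ} (ha : IsStar γ t a) (hb : IsStar γ t b) :
    a = b := by
  rcases lt_trichotomy a b with hab | hab | hab
  · exact (h.isStar_unique_aux ha hb hab).elim
  · exact hab
  · exact (h.isStar_unique_aux hb ha hab).elim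

lemma isStar_star (h : IsOval γ σ) (t : ℝ) : IsStar γ t (star γ t) :=
  Classical.epsilon_spec (h.exists_isStar t)

lemma eq_star (h : IsOval γ σ) {t τ : ℝ} (hτ : IsStar γ t τ) : τ = star γ t :=
  h.isStar_unique hτ (h.isStar_star t)

lemma lt_star (h : IsOval γ σ) (t : ℝ) : t < star γ t := (h.isStar_star t).1.1

lemma star_lt (h : IsOval γ σ) (t : ℝ) : star γ t < t + 1 := (h.isStar_star t).1.2

lemma star_add_int (h : IsOval γ σ) (t : ℝ) (k : ℤ) : star γ (t + k) = star γ t + k := by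
  have h1 := h.isStar_star t
  refine (h.eq_star ⟨⟨?_, ?_⟩, ?_⟩).symm
  · linarith [h1.1.1]
  · linarith [h1.1.2]
  · rw [h.deriv_add_int, h.deriv_add_int]; exact h1.2

lemma mem_phaseSpace (h : IsOval γ σ) {t u : ℝ} :
    (t, u) ∈ phaseSpace γ ↔ t < u ∧ u < star γ t := by
  constructor
  · rintro ⟨τ, hτ, h0, h1, h2⟩
    obtain rfl := h.eq_star ⟨hτ, h0⟩
    exact ⟨h1, h2⟩
  · rintro ⟨h1, h2⟩
    exact ⟨_, (h.isStar_star t).1, (h.isStar_star t).2, h1, h2⟩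

/-- The derivative of the height above the tangent line at `t` is positive until `star γ t`. -/
lemma area_deriv_pos (h : IsOval γ σ) {t u : ℝ} (h1 : t < u) (h2 : u < star γ t) :
    0 < σ * area (deriv γ t) (deriv γ u) := by
  have hne : ∀ v ∈ Ioo t (star γ t), σ * area (deriv γ t) (deriv γ v) ≠ 0 := by
    intro v hv h0
    have := (mul_eq_zero.1 h0).resolve_left h.ne_zero
    exact hv.2.ne (h.eq_star ⟨⟨hv.1, hv.2.trans (h.star_lt t)⟩, this⟩)
  have hd : ∀ v, HasDerivAt (fun u => σ * area (deriv γ t) (γ u))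
      (σ * area (deriv γ t) (deriv γ v)) v := fun v => (h.hasDerivAt_area _ v).const_mul σ
  have hcont : Continuous fun v => σ * area (deriv γ t) (deriv γ v) :=
    continuous_const.mul (continuous_area.comp (continuous_const.prodMk h.continuous_deriv))
  -- The mean value theorem gives one point with positive derivative; since the derivative has no
  -- zero before `star γ t`, this sign is the sign everywhere.
  obtain ⟨v, hv, hv'⟩ := exists_hasDerivAt_eq_slope (fun u => σ * area (deriv γ t) (γ u))
    (fun v => σ * area (deriv γ t) (deriv γ v)) (h.lt_star t)
    (fun v _ => (hd v).continuousAt.continuousWithinAt) (fun v _ => hd v)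
  have hpos : 0 < σ * area (deriv γ t) (deriv γ v) := by
    rw [hv']
    exact div_pos (sub_pos.2 (h.lt_area (h.lt_star t) (h.star_lt t))) (sub_pos.2 (h.lt_star t))
  by_contra hneg
  push Not at hneg
  obtain ⟨w, hw, hw0⟩ := isPreconnected_Ioo.intermediate_value ⟨h1, h2⟩ hv hcont.continuousOn
    ⟨hneg, hpos.le⟩
  exact hne w hw hw0

lemma strictMonoOn_area (h : IsOval γ σ) (t : ℝ) :
    StrictMonoOn (fun u => σ * area (deriv γ t) (γ u)) (Icc t (star γ t)) := by
  refine strictMonoOn_of_hasDerivWithinAt_pos (convex_Icc _ _)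
    (f' := fun v => σ * area (deriv γ t) (deriv γ v))
    (fun v _ => ((h.hasDerivAt_area _ v).const_mul σ).continuousAt.continuousWithinAt)
    (fun v _ => ((h.hasDerivAt_area _ v).const_mul σ).hasDerivWithinAt) ?_
  intro v hv
  rw [interior_Icc] at hv
  exact h.area_deriv_pos hv.1 hv.2

lemma area_injOn (h : IsOval γ σ) (t : ℝ) :
    InjOn (fun u => area (deriv γ t) (γ u)) (Icc t (star γ t)) := by
  intro u hu v hv huv
  refine (h.strictMonoOn_area t).injOn hu hv ?_
  simp only at huv ⊢
  rw [huv]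

lemma star_star (h : IsOval γ σ) (t : ℝ) : star γ (star γ t) = t + 1 := by
  have h1 := h.isStar_star t
  refine (h.eq_star ⟨⟨h1.1.2, by linarith [h1.1.1]⟩, ?_⟩).symm
  rw [h.deriv_periodic, area_swap, h1.2, neg_zero]

/-- If `star γ u` exceeded `t + 1`, then `area` of the tangents at `t` and `u` would have the sign
of `σ` in both orders, against antisymmetry. This is the source of the bound `1/2` on rotation
numbers. -/
lemma star_le_add_one (h : IsOval γ σ) {t u : ℝ} (h1 : t < u) (h2 : u < star γ t) :
    star γ u ≤ t + 1 := by
  by_contra hcon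
  push Not at hcon
  have e1 := h.area_deriv_pos h1 h2
  have e2 := h.area_deriv_pos (by linarith [h.star_lt t]) hcon
  rw [h.deriv_periodic, area_swap] at e2
  linarith

/-- The height above the tangent line at `t` is maximal exactly at `star γ t`. -/
lemma area_lt_star (h : IsOval γ σ) {t u : ℝ} (h1 : t ≤ u) (h2 : u ≤ t + 1)
    (hne : u ≠ star γ t) :
    σ * area (deriv γ t) (γ u) < σ * area (deriv γ t) (γ (star γ t)) := by
  rcases lt_or_gt_of_ne hne with hlt | hlt
  · exact h.strictMonoOn_area t ⟨h1, hlt.le⟩ ⟨(h.lt_star t).le, le_rfl⟩ hlt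
  · obtain ⟨c, hc⟩ := exists_smul_eq_of_area_eq_zero (h.deriv_ne_zero t) (h.isStar_star t).2
    have e1 := h.lt_area (h.lt_star t) (h.star_lt t)
    have e2 := h.lt_area (t := star γ t) (u := t + 1) (h.star_lt t)
      (by linarith [h.lt_star t])
    have e3 := h.lt_area (t := star γ t) (u := u) hlt (by linarith [h.lt_star t])
    rw [hc, smul_area, smul_area] at e2 e3
    rw [h.periodic] at e2
    have hc' : c < 0 := by nlinarith
    nlinarith

/-- A description of `star γ t` by non-strict inequalities that do not mention `σ`, so that it
passes to limits of ovals; maximality excludes the endpoints `t` and `t + 1` automatically. -/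
lemma eq_star_of_forall_abs_le (h : IsOval γ σ) {t τ : ℝ} (h1 : t ≤ τ) (h2 : τ ≤ t + 1)
    (hle : ∀ u, |area (deriv γ t) (γ u - γ t)| ≤ |area (deriv γ t) (γ τ - γ t)|) :
    τ = star γ t := by
  by_contra hne
  have e1 := h.area_lt_star h1 h2 hne
  have e2 := mul_le_mul_of_nonneg_left (hle (star γ t)) (abs_nonneg σ)
  rw [← abs_mul, ← abs_mul] at e2
  have e3 := h.pos t _ (h.lt_star t) (h.star_lt t)
  rw [abs_of_pos e3] at e2
  have e4 : 0 ≤ σ * area (deriv γ t) (γ τ - γ t) := by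
    rcases h1.eq_or_lt with rfl | h1
    · simp [area_zero_right]
    · rcases h2.eq_or_lt with rfl | h2
      · rw [h.periodic]; simp [area_zero_right]
      · exact (h.pos t τ h1 h2).le
  rw [abs_of_nonneg e4] at e2
  simp only [area_sub, mul_sub] at e2
  linarith

lemma abs_area_le_star (h : IsOval γ σ) (t u : ℝ) :
    |area (deriv γ t) (γ u - γ t)| ≤ |area (deriv γ t) (γ (star γ t) - γ t)| := by
  obtain ⟨k, hk, -⟩ := existsUnique_add_zsmul_mem_Ico (one_pos : (0 : ℝ) < 1) u t
  simp only [zsmul_eq_mul, mul_one] at hk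
  rw [← h.add_int u k]
  set v := u + k
  have e3 := h.pos t _ (h.lt_star t) (h.star_lt t)
  have hle : σ * area (deriv γ t) (γ v) ≤ σ * area (deriv γ t) (γ (star γ t)) := by
    by_cases hv : v = star γ t
    · rw [hv]
    · exact (h.area_lt_star hk.1 hk.2.le hv).le
  have e4 : 0 ≤ σ * area (deriv γ t) (γ v - γ t) := by
    rcases hk.1.eq_or_lt with h1 | h1
    · rw [← h1]; simp [area_zero_right]
    · exact (h.pos t v h1 hk.2).le
  have hσ : 0 < |σ| := abs_pos.2 h.ne_zero
  rw [← mul_le_mul_iff_right₀ hσ, ← abs_mul, ← abs_mul, abs_of_nonneg e4, abs_of_pos e3]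
  simp only [area_sub, mul_sub]
  linarith

/-! ### The billiard map of an oval. -/

lemma coord_injOn (h : IsOval γ σ) : InjOn (coord γ) (phaseSpace γ) := by
  rintro ⟨t, u⟩ hx ⟨t', u'⟩ hy hxy
  simp only [coord, Prod.mk.injEq] at hxy
  obtain ⟨rfl, h2⟩ := hxy
  rw [h.mem_phaseSpace] at hx hy
  rw [h.area_injOn t ⟨hx.1.le, hx.2.le⟩ ⟨hy.1.le, hy.2.le⟩ h2]

/-- Above the tangent at `u`, the height of `γ t = γ (t + 1)` lies strictly between those at `u` and
at `star γ u`, so it is attained in between. Here `t + 1 ≠ star γ u` because the tangents at `t` and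
`u` are not parallel. -/
lemma exists_isBounce (h : IsOval γ σ) {t u : ℝ} (hx : (t, u) ∈ phaseSpace γ) :
    ∃ w, IsBounce γ t u w := by
  have hx' := h.mem_phaseSpace.1 hx
  have h1 : t + 1 ≠ star γ u := by
    intro h0
    have := (h.isStar_star u).2
    rw [← h0, h.deriv_periodic, area_swap] at this
    have h3 := h.area_deriv_pos hx'.1 hx'.2
    rw [neg_eq_zero.1 this] at h3
    simp at h3
  have h2 := h.star_lt t
  have e1 := h.area_lt_star (t := u) (u := t + 1) (by linarith) (by linarith) h1
  have e2 := h.lt_area (t := u) (u := t + 1) (by linarith) (by linarith)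
  rw [h.periodic] at e1 e2
  have hc : ContinuousOn (fun w => σ * area (deriv γ u) (γ w)) (Icc u (star γ u)) :=
    fun v _ => ((h.hasDerivAt_area _ v).const_mul σ).continuousAt.continuousWithinAt
  obtain ⟨w, hw, hw0⟩ := intermediate_value_Ioo (h.lt_star u).le hc ⟨e2, e1⟩
  refine ⟨w, hx, h.mem_phaseSpace.2 hw, ?_⟩
  rw [area_sub, mul_left_cancel₀ h.ne_zero hw0, sub_self]

lemma isBounce_unique (h : IsOval γ σ) {t u w w' : ℝ} (hw : IsBounce γ t u w)
    (hw' : IsBounce γ t u w') : w = w' := by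
  have h1 := h.mem_phaseSpace.1 hw.2.1
  have h2 := h.mem_phaseSpace.1 hw'.2.1
  refine h.area_injOn u ⟨h1.1.le, h1.2.le⟩ ⟨h2.1.le, h2.2.le⟩ ?_
  have h3 := hw.2.2
  have h4 := hw'.2.2
  rw [area_sub] at h3 h4
  simp only
  linarith

/-- Uniqueness of coordinates and of the bounce removes both choices from the definition of
`twistMap`; dynamics can then be checked on impact parameters. -/
lemma twistMap_coord (h : IsOval γ σ) {t u w : ℝ} (hw : IsBounce γ t u w) :
    twistMap γ (coord γ (t, u)) = coord γ (u, w) := by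
  unfold twistMap
  rw [h.coord_injOn.leftInvOn_invFunOn hw.1, billiardMap]
  congr 2
  exact h.isBounce_unique (Classical.epsilon_spec (p := fun t₃ => IsBounce γ t u t₃) ⟨w, hw⟩) hw

end IsOval

end SymplecticBilliard

namespace SymplecticBilliard

/-! ### Convergence of ovals -/

/-- The ovals `Γ k` converge to `γ` along `l`, locally uniformly together with their
derivatives. -/
structure CurveTendsto {ι : Type*} (l : Filter ι) (Γ : ι → ℝ → Plane) (γ : ℝ → Plane) :
    Prop where
  eventually_isOval : ∀ᶠ k in l, ∃ σ, IsOval (Γ k) σ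
  tendsto : ∀ s : ℝ, Tendsto (fun p : ι × ℝ => Γ p.1 p.2) (l ×ˢ 𝓝 s) (𝓝 (γ s))
  tendsto_deriv : ∀ s : ℝ,
    Tendsto (fun p : ι × ℝ => deriv (Γ p.1) p.2) (l ×ˢ 𝓝 s) (𝓝 (deriv γ s))

namespace CurveTendsto

variable {ι : Type*} {l l' : Filter ι} {Γ : ι → ℝ → Plane} {γ : ℝ → Plane} {σ : ℝ}

lemma mono (h : CurveTendsto l Γ γ) (hl : l' ≤ l) : CurveTendsto l' Γ γ :=
  ⟨h.1.filter_mono hl, fun s => (h.2 s).mono_left (prod_mono_left _ hl),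
    fun s => (h.3 s).mono_left (prod_mono_left _ hl)⟩

lemma const (h : IsOval γ σ) : CurveTendsto l (fun _ => γ) γ :=
  ⟨Eventually.of_forall fun _ => ⟨σ, h⟩, fun s => (h.continuous.tendsto s).comp tendsto_snd,
    fun s => (h.continuous_deriv.tendsto s).comp tendsto_snd⟩

lemma apply (h : CurveTendsto l Γ γ) {s : ι → ℝ} {s₀ : ℝ} (hs : Tendsto s l (𝓝 s₀)) :
    Tendsto (fun k => Γ k (s k)) l (𝓝 (γ s₀)) :=
  (h.2 s₀).comp (tendsto_id.prodMk hs)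

lemma apply_deriv (h : CurveTendsto l Γ γ) {s : ι → ℝ} {s₀ : ℝ} (hs : Tendsto s l (𝓝 s₀)) :
    Tendsto (fun k => deriv (Γ k) (s k)) l (𝓝 (deriv γ s₀)) :=
  (h.3 s₀).comp (tendsto_id.prodMk hs)

/-- Along an ultrafilter the bounded values converge, and the limit inherits the maximality of the
absolute height, which identifies it. -/
lemma tendsto_star (h : CurveTendsto l Γ γ) (hγ : IsOval γ σ) {t : ι → ℝ} {t₀ : ℝ}
    (ht : Tendsto t l (𝓝 t₀)) : Tendsto (fun k => star (Γ k) (t k)) l (𝓝 (star γ t₀)) := by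
  rw [tendsto_iff_ultrafilter]
  intro g hg
  have hG := h.mono hg
  have htg := ht.mono_left hg
  have hmem : ∀ᶠ k in g, star (Γ k) (t k) ∈ Icc (t₀ - 1) (t₀ + 2) := by
    filter_upwards [hG.1, htg.eventually_const_lt (sub_one_lt t₀),
      htg.eventually_lt_const (lt_add_one t₀)] with k ⟨σ', hk⟩ h1 h2
    exact ⟨by linarith [hk.lt_star (t k)], by linarith [hk.star_lt (t k)]⟩
  obtain ⟨τ, -, hτ⟩ := (isCompact_Icc (a := t₀ - 1) (b := t₀ + 2)).ultrafilter_le_nhds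
    (g.map fun k => star (Γ k) (t k)) (le_principal_iff.2 hmem)
  replace hτ : Tendsto (fun k => star (Γ k) (t k)) g (𝓝 τ) := hτ
  suffices τ = star γ t₀ by rw [← this]; exact hτ
  apply hγ.eq_star_of_forall_abs_le
  · exact le_of_tendsto_of_tendsto htg hτ (hG.1.mono fun k ⟨_, hk⟩ => (hk.lt_star _).le)
  · exact le_of_tendsto_of_tendsto hτ (htg.add_const 1)
      (hG.1.mono fun k ⟨_, hk⟩ => (hk.star_lt _).le)
  · intro u
    have hlim : ∀ {s : ι → ℝ} {s₀ : ℝ}, Tendsto s g (𝓝 s₀) →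
        Tendsto (fun k => |area (deriv (Γ k) (t k)) (Γ k (s k) - Γ k (t k))|) g
          (𝓝 |area (deriv γ t₀) (γ s₀ - γ t₀)|) := fun hs =>
      ((continuous_area.tendsto (deriv γ t₀, γ _ - γ t₀)).comp
        ((hG.apply_deriv htg).prodMk_nhds ((hG.apply hs).sub (hG.apply htg)))).abs
    exact le_of_tendsto_of_tendsto (hlim (tendsto_const_nhds (x := u))) (hlim hτ)
      (hG.1.mono fun k ⟨_, hk⟩ => hk.abs_area_le_star _ _)

end CurveTendsto

/-! ### Resonant lifts -/

/-- `f` is the lift of a circle homeomorphism describing an `(m, n)`-periodic invariant curve of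
the billiard map: `(t, f t, f (f t))` are successive impact points, for every `t`. -/
structure IsResonant (γ : ℝ → Plane) (m : ℤ) (n : ℕ) (f : ℝ → ℝ) : Prop where
  continuous : Continuous f
  add_one : ∀ t, f (t + 1) = f t + 1
  lt : ∀ t, t < f t
  lt_star : ∀ t, f t < star γ t
  bounce : ∀ t, area (deriv γ (f t)) (γ (f (f t)) - γ t) = 0
  iterate : ∀ t, f^[n] t = t + m

variable {γ : ℝ → Plane} {σ : ℝ} {m : ℤ} {n : ℕ} {f : ℝ → ℝ}

/-- The lift sends `t` to the second impact whose height is `g t`. It is continuous because a limit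
of its values lies in `[t, star γ t]`, where the height is injective, and `g` is continuous. -/
theorem HasPeriodicInvariantCurve.exists_isResonant (h : IsOval γ σ)
    (hc : HasPeriodicInvariantCurve γ m n) : ∃ f, IsResonant γ m n f := by
  obtain ⟨g, ⟨K, hK⟩, hper, hstrip, hinv, hit⟩ := hc
  have hex : ∀ t, ∃ u, (t, u) ∈ phaseSpace γ ∧ area (deriv γ t) (γ u) = g t := by
    intro t
    obtain ⟨⟨a, b⟩, hx, hx'⟩ := hstrip t
    simp only [coord, Prod.mk.injEq] at hx'
    obtain ⟨rfl, h2⟩ := hx'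
    exact ⟨b, hx, h2⟩
  choose f hfP hfg using hex
  have hco : ∀ t, coord γ (t, f t) = (t, g t) := fun t => by simp only [coord, hfg]
  have hb : ∀ t, IsBounce γ t (f t) (f (f t)) := by
    intro t
    obtain ⟨w, hw⟩ := h.exists_isBounce (hfP t)
    obtain ⟨t', ht'⟩ := hinv t
    rw [← hco t, h.twistMap_coord hw, ← hco t'] at ht'
    have := h.coord_injOn hw.2.1 (hfP t') ht'
    simp only [Prod.mk.injEq] at this
    obtain ⟨h1, h2⟩ := this
    rw [← h1] at h2
    rwa [h2] at hw
  have hiter : ∀ k t, (twistMap γ)^[k] (t, g t) = (f^[k] t, g (f^[k] t)) := by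
    intro k
    induction k with
    | zero => intro t; rfl
    | succ k ih =>
      intro t
      rw [Function.iterate_succ_apply, Function.iterate_succ_apply, ← ih (f t), ← hco t,
        h.twistMap_coord (hb t), hco]
  refine ⟨f, ?_, ?_, fun t => (h.mem_phaseSpace.1 (hfP t)).1,
    fun t => (h.mem_phaseSpace.1 (hfP t)).2, fun t => (hb t).2.2, fun t => ?_⟩
  · rw [continuous_iff_continuousAt]
    intro t
    rw [ContinuousAt, tendsto_iff_ultrafilter]
    intro U hU
    have htU : Tendsto (fun s : ℝ => s) U (𝓝 t) := hU
    have hlt := fun s => (h.mem_phaseSpace.1 (hfP s))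
    have hmem : ∀ᶠ s in U, f s ∈ Icc (t - 1) (t + 2) := by
      filter_upwards [htU.eventually_const_lt (sub_one_lt t),
        htU.eventually_lt_const (lt_add_one t)] with s h1 h2
      exact ⟨by linarith [hlt s], by linarith [(hlt s).2, h.star_lt s]⟩
    obtain ⟨u, -, hu⟩ := (isCompact_Icc (a := t - 1) (b := t + 2)).ultrafilter_le_nhds
      (U.map f) (le_principal_iff.2 hmem)
    replace hu : Tendsto f U (𝓝 u) := hu
    suffices u = f t by rw [← this]; exact hu
    have hstar := (CurveTendsto.const (l := (U : Filter ℝ)) h).tendsto_star h htU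
    have h1 : t ≤ u := le_of_tendsto_of_tendsto' htU hu fun s => (hlt s).1.le
    have h2 : u ≤ star γ t := le_of_tendsto_of_tendsto' hu hstar fun s => (hlt s).2.le
    refine h.area_injOn t ⟨h1, h2⟩ ⟨(hlt t).1.le, (hlt t).2.le⟩ ?_
    have h3 : Tendsto (fun s => area (deriv γ s) (γ (f s))) U
        (𝓝 (area (deriv γ t) (γ u))) :=
      (continuous_area.tendsto (deriv γ t, γ u)).comp
        (((h.continuous_deriv.tendsto t).comp htU).prodMk_nhds
          ((h.continuous.tendsto u).comp hu))
    simp only [hfg] at h3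
    have h4 : Tendsto g U (𝓝 (g t)) := (hK.continuous.tendsto t).comp htU
    simp only
    rw [tendsto_nhds_unique h3 h4, hfg]
  · intro t
    have h1 : (t + 1, f t + 1) ∈ phaseSpace γ := by
      have := h.mem_phaseSpace.1 (hfP t)
      have hs := h.star_add_int t 1
      rw [Int.cast_one] at hs
      exact h.mem_phaseSpace.2 ⟨by linarith, by linarith⟩
    have := h.coord_injOn (hfP (t + 1)) h1 (by
      rw [hco, hper, coord]; simp only [h.deriv_periodic t, h.periodic (f t), hfg])
    simpa using this
  · have := hit t
    rw [hiter] at this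
    exact (Prod.mk.injEq _ _ _ _ ▸ this).1

lemma exists_lipschitzWith_of_periodic {g : ℝ → ℝ} (hg : ContDiff ℝ 1 g)
    (hp : Function.Periodic g 1) : ∃ K, LipschitzWith K g := by
  have hper : Function.Periodic (deriv g) 1 := fun t => by
    rw [← deriv_comp_add_const]
    congr 1
    exact funext hp
  obtain ⟨C, hC⟩ := (hper.isBounded_of_continuous one_ne_zero
    (hg.continuous_deriv le_rfl)).exists_norm_le
  refine ⟨C.toNNReal, lipschitzWith_of_nnnorm_deriv_le (hg.differentiable one_ne_zero)
    fun x => ?_⟩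
  rw [← NNReal.coe_le_coe, coe_nnnorm]
  exact (hC _ (mem_range_self x)).trans (Real.le_coe_toNNReal C)

namespace IsResonant

/-- The converse passage: a `C¹` periodic height function is Lipschitz, and its graph follows the
orbits of `f`. -/
theorem hasPeriodicInvariantCurve (h : IsOval γ σ) (hf : IsResonant γ m n f)
    (hg : ContDiff ℝ 1 fun t => area (deriv γ t) (γ (f t))) :
    HasPeriodicInvariantCurve γ m n := by
  set g : ℝ → ℝ := fun t => area (deriv γ t) (γ (f t))
  have hper : Function.Periodic g 1 := fun t => by
    simp only [g, hf.add_one, h.periodic (f t), h.deriv_periodic t]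
  have hP : ∀ t, (t, f t) ∈ phaseSpace γ := fun t =>
    h.mem_phaseSpace.2 ⟨hf.lt t, hf.lt_star t⟩
  have htw : ∀ t, twistMap γ (t, g t) = (f t, g (f t)) := fun t =>
    h.twistMap_coord ⟨hP t, hP (f t), hf.bounce t⟩
  have hiter : ∀ k t, (twistMap γ)^[k] (t, g t) = (f^[k] t, g (f^[k] t)) := by
    intro k
    induction k with
    | zero => intro t; rfl
    | succ k ih =>
      intro t
      rw [Function.iterate_succ_apply, Function.iterate_succ_apply, ← ih (f t), htw]
  refine ⟨g, exists_lipschitzWith_of_periodic hg hper, hper, fun t => ⟨_, hP t, rfl⟩,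
    fun t => ⟨_, htw t⟩, fun t => ?_⟩
  rw [hiter, hf.iterate]
  congr 1
  simpa using hper.int_mul m t

/-- An iterate of `f` is a translation, so `f` is injective; a continuous injection is monotone, and
`f 1 = f 0 + 1` rules out a decreasing one. -/
lemma strictMono (hf : IsResonant γ m n f) (hn : 0 < n) : StrictMono f := by
  have hinj : Function.Injective f := by
    intro a b hab
    obtain ⟨k, rfl⟩ := Nat.exists_eq_succ_of_ne_zero hn.ne'
    have h1 := hf.iterate a
    have h2 := hf.iterate b
    rw [Function.iterate_succ_apply] at h1 h2
    rw [hab] at h1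
    linarith
  refine (hf.continuous.strictMono_of_inj hinj).resolve_right fun hanti => ?_
  have := hanti (zero_lt_one' ℝ)
  have h1 := hf.add_one 0
  rw [zero_add] at h1
  linarith

lemma apply_apply_lt (h : IsOval γ σ) (hf : IsResonant γ m n f) (t : ℝ) : f (f t) < t + 1 :=
  (hf.lt_star (f t)).trans_le (h.star_le_add_one (hf.lt t) (hf.lt_star t))

lemma iterate_add_one (hf : IsResonant γ m n f) (i : ℕ) (t : ℝ) :
    f^[i] (t + 1) = f^[i] t + 1 := by
  induction i generalizing t with
  | zero => rfl
  | succ i ih => rw [Function.iterate_succ_apply, hf.add_one, ih, Function.iterate_succ_apply]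

lemma iterate_add_int (hf : IsResonant γ m n f) (i : ℕ) (t : ℝ) (k : ℤ) :
    f^[i] (t + k) = f^[i] t + k := by
  have : Function.Periodic (fun t => f^[i] t - t) 1 := fun t => by
    simp only [hf.iterate_add_one]; ring
  have := this.int_mul k t
  simp only [mul_one] at this
  linarith

lemma iterate_period (hf : IsResonant γ m n f) (i : ℕ) (t : ℝ) :
    f^[i + n] t = f^[i] t + m := by
  rw [Function.iterate_add_apply, hf.iterate, hf.iterate_add_int]

/-- Iterating `f (f t) < t + 1` gives `f^[2 * n] 0 < n`, while periodicity makes the left side `2 *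
m`. -/
lemma two_mul_lt (h : IsOval γ σ) (hf : IsResonant γ m n f) (hn : 0 < n) : 2 * m < n := by
  have h1 : ∀ k : ℕ, f^[2 * (k + 1)] 0 < (k + 1 : ℕ) := by
    intro k
    induction k with
    | zero => simpa using hf.apply_apply_lt h 0
    | succ k ih =>
      have := hf.apply_apply_lt h (f^[2 * (k + 1)] 0)
      rw [← Function.iterate_succ_apply' f, ← Function.iterate_succ_apply' f] at this
      have e : 2 * (k + 1 + 1) = (2 * (k + 1)).succ.succ := by omega
      rw [e]
      push_cast at ih ⊢
      linarith
  obtain ⟨k, rfl⟩ := Nat.exists_eq_succ_of_ne_zero hn.ne'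
  have h2 := h1 k
  have e : 2 * (k + 1) = (k + 1) + (k + 1) := by ring
  rw [e, hf.iterate_period, hf.iterate] at h2
  have : (2 * m : ℝ) < ((k + 1 : ℕ) : ℝ) := by linarith
  exact_mod_cast this

end IsResonant

end SymplecticBilliard

namespace SymplecticBilliard

/-! ### Analytic families of ovals -/

/-- An analytic family of ovals over the open set `J` of parameters. -/
structure IsOvalFamily (J : Set ℝ) (γ : ℝ → ℝ → Plane) : Prop where
  isOpen : IsOpen J
  analytic : AnalyticOnNhd ℝ (fun x : ℝ × ℝ => γ x.1 x.2) (J ×ˢ univ)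
  oval : ∀ ε ∈ J, ∃ σ, IsOval (γ ε) σ

lemma hasDerivAt_of_analyticAt {γ : ℝ → ℝ → Plane} {ε t : ℝ}
    (h : AnalyticAt ℝ (fun x : ℝ × ℝ => γ x.1 x.2) (ε, t)) :
    HasDerivAt (γ ε) (fderiv ℝ (fun x : ℝ × ℝ => γ x.1 x.2) (ε, t) (0, 1)) t :=
  h.differentiableAt.hasFDerivAt.comp_hasDerivAt t
    ((hasDerivAt_const t ε).prodMk (hasDerivAt_id t))

lemma analyticOnNhd_deriv {γ : ℝ → ℝ → Plane} {J : Set ℝ} (hJ : IsOpen J)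
    (h : AnalyticOnNhd ℝ (fun x : ℝ × ℝ => γ x.1 x.2) (J ×ˢ univ)) :
    AnalyticOnNhd ℝ (fun x : ℝ × ℝ => deriv (γ x.1) x.2) (J ×ˢ univ) := by
  have h1 : AnalyticOnNhd ℝ
      (fun x : ℝ × ℝ => fderiv ℝ (fun x : ℝ × ℝ => γ x.1 x.2) x (0, 1)) (J ×ˢ univ) :=
    fun x hx => (ContinuousLinearMap.apply ℝ Plane ((0 : ℝ), (1 : ℝ))).analyticAt _ |>.comp
      (h.fderiv x hx)
  exact h1.congr (hJ.prod isOpen_univ) fun x hx => (hasDerivAt_of_analyticAt (h x hx)).deriv.symm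

lemma _root_.AnalyticAt.area {X : Type*} [NormedAddCommGroup X] [NormedSpace ℝ X]
    {a b : X → Plane} {x : X} (ha : AnalyticAt ℝ a x) (hb : AnalyticAt ℝ b x) :
    AnalyticAt ℝ (fun y => area (a y) (b y)) x := by
  have hp : ∀ {c : X → Plane}, AnalyticAt ℝ c x → ∀ i, AnalyticAt ℝ (fun y => c y i) x :=
    fun hc i => (EuclideanSpace.proj i : Plane →L[ℝ] ℝ).analyticAt _ |>.comp hc
  exact ((hp ha 0).mul (hp hb 1)).sub ((hp ha 1).mul (hp hb 0))

/-- The defect in the reflection law for the successive parameters `(u, v, w)`, on the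
boundary with parameter `ε`. -/
noncomputable def bounceDefect (γ : ℝ → ℝ → Plane) (p : ℝ × ℝ × ℝ × ℝ) : ℝ :=
  area (deriv (γ p.1) p.2.2.1) (γ p.1 p.2.2.2 - γ p.1 p.2.1)

namespace IsOvalFamily

variable {J : Set ℝ} {γ : ℝ → ℝ → Plane} {X : Type*} [NormedAddCommGroup X] [NormedSpace ℝ X]

lemma analyticAt (h : IsOvalFamily J γ) {e u : X → ℝ} {x : X} (he : AnalyticAt ℝ e x)
    (hu : AnalyticAt ℝ u x) (hx : e x ∈ J) : AnalyticAt ℝ (fun y => γ (e y) (u y)) x :=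
  AnalyticAt.comp (g := fun x : ℝ × ℝ => γ x.1 x.2) (f := fun y => (e y, u y))
    (h.analytic (e x, u x) ⟨hx, mem_univ _⟩) (he.prod hu)

lemma analyticAt_deriv (h : IsOvalFamily J γ) {e u : X → ℝ} {x : X} (he : AnalyticAt ℝ e x)
    (hu : AnalyticAt ℝ u x) (hx : e x ∈ J) :
    AnalyticAt ℝ (fun y => deriv (γ (e y)) (u y)) x :=
  AnalyticAt.comp (g := fun x : ℝ × ℝ => deriv (γ x.1) x.2) (f := fun y => (e y, u y))
    (analyticOnNhd_deriv h.isOpen h.analytic (e x, u x) ⟨hx, mem_univ _⟩) (he.prod hu)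

lemma analyticAt_bounceDefect (h : IsOvalFamily J γ) {e u v w : X → ℝ} {x : X}
    (he : AnalyticAt ℝ e x) (hu : AnalyticAt ℝ u x) (hv : AnalyticAt ℝ v x)
    (hw : AnalyticAt ℝ w x) (hx : e x ∈ J) :
    AnalyticAt ℝ (fun y => bounceDefect γ (e y, u y, v y, w y)) x :=
  (h.analyticAt_deriv he hv hx).area ((h.analyticAt he hw hx).sub (h.analyticAt he hu hx))

lemma hasStrictFDerivAt_bounceDefect (h : IsOvalFamily J γ) {p : ℝ × ℝ × ℝ × ℝ}
    (hp : p.1 ∈ J) :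
    HasStrictFDerivAt (bounceDefect γ) (fderiv ℝ (bounceDefect γ) p) p :=
  (h.analyticAt_bounceDefect (e := fun p : ℝ × ℝ × ℝ × ℝ => p.1) (u := fun p => p.2.1)
    (v := fun p => p.2.2.1) (w := fun p => p.2.2.2) analyticAt_fst (analyticAt_fst.comp analyticAt_snd)
    (analyticAt_fst.comp (analyticAt_snd.comp analyticAt_snd))
    (analyticAt_snd.comp (analyticAt_snd.comp analyticAt_snd)) hp).hasStrictFDerivAt

/-- The outer coefficients are `area` of consecutive tangents. Thus along an orbit the linearized
law is the symmetric three-term recurrence `b i * ξ i + a i * ξ (i + 1) + b (i + 1) * ξ (i + 2)`,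
with `σ * b i` positive. -/
lemma fderiv_bounceDefect (h : IsOvalFamily J γ) {ε u v w : ℝ} (hε : ε ∈ J) (a b c : ℝ) :
    fderiv ℝ (bounceDefect γ) (ε, u, v, w) (0, a, b, c) =
      area (deriv (γ ε) u) (deriv (γ ε) v) * a
        + fderiv ℝ (bounceDefect γ) (ε, u, v, w) (0, 0, 1, 0) * b
        + area (deriv (γ ε) v) (deriv (γ ε) w) * c := by
  obtain ⟨σ, hσ⟩ := h.oval ε hε
  have hE := (h.hasStrictFDerivAt_bounceDefect (p := (ε, u, v, w)) hε).hasFDerivAt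
  have hd := fun t => (hσ.differentiable t).hasDerivAt
  have h1 : fderiv ℝ (bounceDefect γ) (ε, u, v, w) (0, 1, 0, 0) =
      area (deriv (γ ε) u) (deriv (γ ε) v) := by
    have e1 := hE.comp_hasDerivAt u ((hasDerivAt_const u ε).prodMk ((hasDerivAt_id u).prodMk
      ((hasDerivAt_const u v).prodMk (hasDerivAt_const u w))))
    have e2 : HasDerivAt (fun u => area (deriv (γ ε) v) (γ ε w - γ ε u))
        (area (deriv (γ ε) v) (0 - deriv (γ ε) u)) u :=
      hasDerivAt_area_right _ ((hasDerivAt_const u _).sub (hd u))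
    have := e1.unique e2
    rw [this, area_sub, area_zero_right, area_swap]
    ring
  have h3 : fderiv ℝ (bounceDefect γ) (ε, u, v, w) (0, 0, 0, 1) =
      area (deriv (γ ε) v) (deriv (γ ε) w) := by
    have e1 := hE.comp_hasDerivAt w ((hasDerivAt_const w ε).prodMk ((hasDerivAt_const w u).prodMk
      ((hasDerivAt_const w v).prodMk (hasDerivAt_id w))))
    have e2 : HasDerivAt (fun w => area (deriv (γ ε) v) (γ ε w - γ ε u))
        (area (deriv (γ ε) v) (deriv (γ ε) w - 0)) w :=
      hasDerivAt_area_right _ ((hd w).sub (hasDerivAt_const w _))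
    have := e1.unique e2
    rw [this, sub_zero]
  have hdec : ((0 : ℝ), a, b, c) = a • ((0 : ℝ), (1 : ℝ), (0 : ℝ), (0 : ℝ))
      + b • ((0 : ℝ), (0 : ℝ), (1 : ℝ), (0 : ℝ)) + c • ((0 : ℝ), (0 : ℝ), (0 : ℝ), (1 : ℝ)) := by
    simp
  rw [hdec, map_add, map_add, map_smul, map_smul, map_smul, h1, h3]
  simp only [smul_eq_mul]
  ring

lemma curveTendsto (h : IsOvalFamily J γ) {ε₀ : ℝ} (hε : ε₀ ∈ J) {l : Filter ℝ}
    (hl : l ≤ 𝓝 ε₀) : CurveTendsto l γ (γ ε₀) := by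
  refine CurveTendsto.mono ⟨?_, fun s => ?_, fun s => ?_⟩ hl
  · filter_upwards [h.isOpen.mem_nhds hε] with ε he using h.oval ε he
  · rw [← nhds_prod_eq]
    exact (h.analytic (ε₀, s) ⟨hε, mem_univ _⟩).continuousAt
  · rw [← nhds_prod_eq]
    exact (analyticOnNhd_deriv h.isOpen h.analytic (ε₀, s) ⟨hε, mem_univ _⟩).continuousAt

lemma continuousAt_star (h : IsOvalFamily J γ) {ε t : ℝ} (hε : ε ∈ J) :
    ContinuousAt (fun p : ℝ × ℝ => star (γ p.1) p.2) (ε, t) := by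
  obtain ⟨σ, hσ⟩ := h.oval ε hε
  have hl : CurveTendsto (𝓝 (ε, t)) (fun p : ℝ × ℝ => γ p.1) (γ ε) := by
    have hbase := h.curveTendsto hε le_rfl
    have hfst : Tendsto (Prod.fst : ℝ × ℝ → ℝ) (𝓝 (ε, t)) (𝓝 ε) := continuousAt_fst
    exact ⟨hfst.eventually hbase.1, fun s => (hbase.2 s).comp (hfst.prodMap tendsto_id),
      fun s => (hbase.3 s).comp (hfst.prodMap tendsto_id)⟩
  exact hl.tendsto_star hσ continuousAt_snd

end IsOvalFamily

/-! ### Limits of resonant orbits -/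

section Limit

variable {ι : Type*} {U : Ultrafilter ι} {Γ : ι → ℝ → Plane} {γ : ℝ → Plane} {σ : ℝ}
  {F : ι → ℝ → ℝ} {m : ℤ} {n : ℕ}

/-- A complete forward billiard orbit with rotation number `m / n`. -/
structure IsPeriodicOrbit (γ : ℝ → Plane) (m : ℤ) (n : ℕ) (T : ℕ → ℝ) : Prop where
  period : ∀ i, T (i + n) = T i + m
  lt : ∀ i, T i < T (i + 1)
  lt_star : ∀ i, T (i + 1) < star γ (T i)
  bounce : ∀ i, area (deriv γ (T (i + 1))) (γ (T (i + 2)) - γ (T i)) = 0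

/-- A degenerate orbit in the closure of the phase space has rotation number `0` or `1 / 2`. -/
lemma isPeriodicOrbit_of_le (h : IsOval γ σ) (hm : 0 < m) (hmn : 2 * m < n) {T : ℕ → ℝ}
    (hper : ∀ i, T (i + n) = T i + m) (hle : ∀ i, T i ≤ T (i + 1))
    (hle' : ∀ i, T (i + 1) ≤ star γ (T i))
    (hb : ∀ i, area (deriv γ (T (i + 1))) (γ (T (i + 2)) - γ (T i)) = 0) :
    IsPeriodicOrbit γ m n T := by
  refine ⟨hper, fun j => (hle j).lt_of_ne fun hj => ?_, fun j => (hle' j).lt_of_ne fun hj => ?_,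
    hb⟩
  -- One coincidence propagates forward by injectivity of heights, so the orbit is constant from `j`
  -- on, against `0 < m`.
  · have hstep : ∀ i, T (j + i) = T j ∧ T (j + i + 1) = T j := by
      intro i
      induction i with
      | zero => exact ⟨rfl, hj.symm⟩
      | succ i ih =>
        refine ⟨ih.2, ?_⟩
        have h1 := hb (j + i)
        rw [area_sub, sub_eq_zero] at h1
        have := h.area_injOn (T (j + i + 1)) ⟨hle _, hle' _⟩
          ⟨ih.2.trans ih.1.symm |>.le, ih.1.trans ih.2.symm |>.le.trans (h.lt_star _).le⟩ h1
        exact this.trans ih.1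
    have := hper j
    rw [(hstep n).1] at this
    have : (0 : ℝ) < m := by exact_mod_cast hm
    linarith
  -- One jump to the opposite point forces all later ones; two of them advance by `1`, so `2 * n`
  -- steps advance by `n` and not by `2 * m`.
  · have hstep : ∀ i, T (j + i + 1) = star γ (T (j + i)) := by
      intro i
      induction i with
      | zero => exact hj
      | succ i ih =>
        have h1 := hb (j + i)
        rw [area_sub, sub_eq_zero, ← h.periodic (T (j + i))] at h1
        have hs : star γ (T (j + i + 1)) = T (j + i) + 1 := by rw [ih, h.star_star]
        have := h.area_injOn (T (j + i + 1)) ⟨hle _, hle' _⟩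
          ⟨by rw [ih]; exact (h.star_lt _).le, hs.ge⟩ h1
        rw [← add_assoc, hs]
        exact this
    have h2 : ∀ i : ℕ, T (j + 2 * i) = T j + i := by
      intro i
      induction i with
      | zero => simp
      | succ i ih =>
        have e : j + 2 * (i + 1) = j + (2 * i + 1) + 1 := by ring
        rw [e, hstep, ← add_assoc, hstep, h.star_star, ih]
        push_cast
        ring
    have h3 := h2 n
    have e : j + 2 * n = j + n + n := by ring
    rw [e, hper, hper] at h3
    have : (2 * m : ℝ) < n := by exact_mod_cast hmn
    linarith

/-- The `i`-th iterates stay in `[t, t + i]`, so they converge along the ultrafilter. The closed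
relations pass to the limit, and the rotation number keeps it off the boundary of the phase space.
-/
lemma exists_tendsto_iterate (hn : 0 < n) (hm : 0 < m) (h : IsOval γ σ)
    (hΓ : CurveTendsto U Γ γ) (hF : ∀ᶠ k in U, IsResonant (Γ k) m n (F k)) (t : ℝ) :
    ∃ T : ℕ → ℝ, T 0 = t ∧ (∀ i, Tendsto (fun k => (F k)^[i] t) U (𝓝 (T i))) ∧
      IsPeriodicOrbit γ m n T := by
  have hex : ∀ i : ℕ, ∃ x, Tendsto (fun k => (F k)^[i] t) U (𝓝 x) := by
    intro i
    have hmem : ∀ᶠ k in U, (F k)^[i] t ∈ Icc t (t + i) := by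
      filter_upwards [hΓ.1, hF] with k ⟨σ', hk⟩ hFk
      induction i with
      | zero => simp
      | succ i ih =>
        rw [Function.iterate_succ_apply']
        have h1 := hFk.lt ((F k)^[i] t)
        have h2 := hFk.lt_star ((F k)^[i] t)
        have h3 := hk.star_lt ((F k)^[i] t)
        push_cast
        exact ⟨by linarith [ih.1], by linarith [ih.2]⟩
    obtain ⟨x, -, hx⟩ := (isCompact_Icc (a := t) (b := t + i)).ultrafilter_le_nhds
      (U.map fun k => (F k)^[i] t) (le_principal_iff.2 hmem)
    exact ⟨x, hx⟩
  choose T hT using hex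
  have hmn : 2 * m < n := by
    obtain ⟨k, ⟨σ', hk⟩, hFk⟩ := (hΓ.1.and hF).exists
    exact hFk.two_mul_lt hk hn
  refine ⟨T, tendsto_nhds_unique (hT 0) (by simp), hT, isPeriodicOrbit_of_le h hm hmn ?_ ?_ ?_ ?_⟩
  · intro i
    refine tendsto_nhds_unique (hT (i + n)) (((hT i).add_const (m : ℝ)).congr' ?_)
    filter_upwards [hF] with k hk using (hk.iterate_period i t).symm
  · intro i
    refine le_of_tendsto_of_tendsto (hT i) (hT (i + 1)) ?_
    filter_upwards [hF] with k hk
    rw [Function.iterate_succ_apply']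
    exact (hk.lt _).le
  · intro i
    refine le_of_tendsto_of_tendsto (hT (i + 1)) (hΓ.tendsto_star h (hT i)) ?_
    filter_upwards [hF] with k hk
    rw [Function.iterate_succ_apply']
    exact (hk.lt_star _).le
  · intro i
    have hlim : Tendsto (fun k => area (deriv (Γ k) ((F k)^[i + 1] t))
        (Γ k ((F k)^[i + 2] t) - Γ k ((F k)^[i] t))) U
        (𝓝 (area (deriv γ (T (i + 1))) (γ (T (i + 2)) - γ (T i)))) :=
      (continuous_area.tendsto (deriv γ _, γ _ - γ _)).comp
        ((hΓ.apply_deriv (hT _)).prodMk_nhds ((hΓ.apply (hT _)).sub (hΓ.apply (hT _))))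
    refine tendsto_nhds_unique hlim (tendsto_const_nhds.congr' ?_)
    filter_upwards [hF] with k hk
    rw [Function.iterate_succ_apply' (F k) (i + 1), Function.iterate_succ_apply' (F k) i]
    exact (hk.bounce _).symm

end Limit

end SymplecticBilliard

namespace SymplecticBilliard

/-! ### Jacobi fields -/

/-- A Jacobi equation with a positive solution is disconjugate. -/
lemma jacobi_eq_zero {n : ℕ} {a b ξ η : ℕ → ℝ} {σ : ℝ} (hb : ∀ i, 0 < σ * b i)
    (hξ : ∀ i, 0 < ξ i)
    (h1 : ∀ i, b i * ξ i + a i * ξ (i + 1) + b (i + 1) * ξ (i + 2) = 0)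
    (h2 : ∀ i, i + 2 ≤ n → b i * η i + a i * η (i + 1) + b (i + 1) * η (i + 2) = 0)
    (h0 : η 0 = 0) (hn : η n = 0) {i : ℕ} (hi : i ≤ n) : η i = 0 := by
  have hb0 : ∀ i, b i ≠ 0 := fun i h => by simpa [h] using hb i
  -- The discrete Wronskian of `ξ` and `η` is constant.
  have hw : ∀ i, i + 1 ≤ n → b i * (ξ i * η (i + 1) - ξ (i + 1) * η i) = b 0 * ξ 0 * η 1 := by
    intro i
    induction i with
    | zero => intro _; rw [h0]; ring_nf
    | succ i ih =>
      intro hi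
      rw [← ih (by omega)]
      linear_combination (ξ (i + 1)) * h2 i hi - (η (i + 1)) * h1 i
  set c := b 0 * ξ 0 * η 1
  -- Dividing the Wronskian identity by `ξ i * ξ (i + 1)` makes the increments of `η / ξ` explicit.
  -- All summands have the sign of `σ`, so `η n = 0` forces `c = 0` unless `n = 0`.
  have hsum : ∀ i, i ≤ n →
      η i / ξ i = c * ∑ j ∈ Finset.range i, (b j * ξ j * ξ (j + 1))⁻¹ := by
    intro i
    induction i with
    | zero => intro _; simp [h0]
    | succ i ih =>
      intro hi
      rw [Finset.sum_range_succ, mul_add, ← ih (by omega), ← hw i hi]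
      have e1 := (hξ i).ne'
      have e2 := (hξ (i + 1)).ne'
      have e3 := hb0 i
      field_simp
      ring
  have hc : n = 0 ∨ c = 0 := by
    rcases n.eq_zero_or_pos with hn0 | hn0
    · exact Or.inl hn0
    right
    have h3 := hsum n le_rfl
    rw [hn, zero_div, eq_comm, mul_eq_zero] at h3
    refine h3.resolve_right fun h4 => ?_
    have h5 : 0 < ∑ j ∈ Finset.range n, σ * (b j * ξ j * ξ (j + 1))⁻¹ := by
      refine Finset.sum_pos (fun j _ => ?_) ⟨0, Finset.mem_range.2 hn0⟩
      have e1 : σ * (b j * ξ j * ξ (j + 1))⁻¹ =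
          σ * b j * ((b j) ^ 2 * (ξ j * ξ (j + 1)))⁻¹ := by
        have := hb0 j
        have := (hξ j).ne'
        have := (hξ (j + 1)).ne'
        field_simp
      rw [e1]
      have := hb0 j
      have := hξ j
      have := hξ (j + 1)
      exact mul_pos (hb j) (by positivity)
    rw [← Finset.mul_sum, h4, mul_zero] at h5
    exact h5.false
  rcases hc with rfl | hc
  · rwa [Nat.le_zero.1 hi]
  · have h3 := hsum i hi
    rw [hc, zero_mul, div_eq_zero_iff] at h3
    exact h3.resolve_right (hξ i).ne'

/-- At a zero of `ξ` with a predecessor the equation says that two terms of the same sign add up to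
`0`, so the next value vanishes too; periodicity carries the zeros all the way round. -/
lemma nonneg_jacobi_pos {n : ℕ} (hn : 0 < n) {a b ξ : ℕ → ℝ} {σ : ℝ} (hb : ∀ i, 0 < σ * b i)
    (hξ : ∀ i, 0 ≤ ξ i) (hper : Function.Periodic ξ n)
    (h1 : ∀ i, b i * ξ i + a i * ξ (i + 1) + b (i + 1) * ξ (i + 2) = 0)
    (hne : ∑ i ∈ Finset.range n, ξ i ≠ 0) (i : ℕ) : 0 < ξ i := by
  refine (hξ i).lt_of_ne fun h0 => hne ?_
  have hb0 : ∀ i, b i ≠ 0 := fun i h => by simpa [h] using hb i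
  have hnext : ∀ k, ξ (k + 1) = 0 → ξ (k + 2) = 0 := by
    intro k hk
    have h2 := congrArg (σ * ·) (h1 k)
    simp only [hk, mul_zero, add_zero, mul_add, ← mul_assoc] at h2
    have e1 := mul_nonneg (hb k).le (hξ k)
    have e2 := mul_nonneg (hb (k + 1)).le (hξ (k + 2))
    have e3 : σ * b (k + 1) * ξ (k + 2) = 0 := by linarith
    exact (mul_eq_zero.1 e3).resolve_left (hb (k + 1)).ne'
  -- Shifting by a full period makes the index positive, so that the zero has a predecessor.
  have hall : ∀ k, ξ (i + n + k) = 0 := by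
    intro k
    induction k with
    | zero => rw [add_zero, hper, ← h0]
    | succ k ih =>
      obtain ⟨l, hl⟩ : ∃ l, i + n + k = l + 1 := ⟨i + n + k - 1, by omega⟩
      rw [hl] at ih
      have := hnext l ih
      rwa [show i + n + (k + 1) = l + 2 by omega]
  refine Finset.sum_eq_zero fun j _ => ?_
  have hp := hper.nat_mul (i + 1) j
  rw [← hp]
  obtain ⟨k, hk⟩ : ∃ k, j + (i + 1) * n = i + n + k := by
    refine Nat.exists_eq_add_of_le ?_
    nlinarith
  have := hall k
  rwa [← hk] at this

/-- Both points move towards `p`; strict differentiability is what controls the difference quotient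
between them. -/
lemma _root_.HasStrictFDerivAt.apply_eq_zero_of_tendsto {ι X Y : Type*} [NormedAddCommGroup X]
    [NormedSpace ℝ X] [NormedAddCommGroup Y] [NormedSpace ℝ Y] {f : X → Y} {f' : X →L[ℝ] Y}
    {p : X} (hf : HasStrictFDerivAt f f' p) {l : Filter ι} [l.NeBot] {x y : ι → X} {c : ι → ℝ}
    {v : X} (hx : Tendsto x l (𝓝 p)) (hy : Tendsto y l (𝓝 p))
    (hxy : ∀ᶠ k in l, f (x k) = f (y k)) (hv : Tendsto (fun k => c k • (x k - y k)) l (𝓝 v)) :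
    f' v = 0 := by
  have h1 := hf.isLittleO.comp_tendsto (hx.prodMk_nhds hy)
  have h2 : (fun k => c k • f' (x k - y k)) =o[l] fun k => c k • (x k - y k) := by
    refine (Asymptotics.isBigO_refl c l).smul_isLittleO ?_
    refine (h1.neg_left).congr' ?_ EventuallyEq.rfl
    filter_upwards [hxy] with k hk
    simp [hk]
  have h3 : Tendsto (fun k => c k • f' (x k - y k)) l (𝓝 0) :=
    (Asymptotics.isLittleO_one_iff ℝ).1 (h2.trans_isBigO (hv.isBigO_one ℝ))
  have h4 : Tendsto (fun k => c k • f' (x k - y k)) l (𝓝 (f' v)) := by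
    simpa only [Function.comp_def, map_smul] using (f'.continuous.tendsto v).comp hv
  exact tendsto_nhds_unique h4 h3

section Family

variable {J : Set ℝ} {γ : ℝ → ℝ → Plane} {ε₀ : ℝ} {U : Ultrafilter ℝ} {m : ℤ} {n : ℕ}
  {F : ℝ → ℝ → ℝ} {T : ℕ → ℝ}

lemma IsPeriodicOrbit.area_deriv_pos {γ : ℝ → Plane} {σ : ℝ} (h : IsOval γ σ)
    (hT : IsPeriodicOrbit γ m n T) (i : ℕ) :
    0 < σ * area (deriv γ (T i)) (deriv γ (T (i + 1))) :=
  h.area_deriv_pos (hT.lt i) (hT.lt_star i)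

/-- The limit of resonant orbits carries a positive periodic Jacobi field, obtained as the limit
of the normalized differences of two neighbouring orbits of the same curve. -/
lemma exists_pos_jacobi (h : IsOvalFamily J γ) (hε : ε₀ ∈ J) (hU : (U : Filter ℝ) ≤ 𝓝[≠] ε₀)
    (hn : 0 < n) (hF : ∀ᶠ ε in U, IsResonant (γ ε) m n (F ε)) {t : ℝ}
    (hlim : ∀ i, Tendsto (fun ε => (F ε)^[i] t) U (𝓝 (T i)))
    (hT : IsPeriodicOrbit (γ ε₀) m n T) :
    ∃ ξ : ℕ → ℝ, (∀ i, 0 < ξ i) ∧ ∀ i,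
      fderiv ℝ (bounceDefect γ) (ε₀, T i, T (i + 1), T (i + 2))
        (0, ξ i, ξ (i + 1), ξ (i + 2)) = 0 := by
  obtain ⟨σ, hσ⟩ := h.oval ε₀ hε
  have hUid : Tendsto (fun ε : ℝ => ε) U (𝓝 ε₀) := hU.trans nhdsWithin_le_nhds
  have hUne : ∀ᶠ ε in U, ε ≠ ε₀ := hU self_mem_nhdsWithin
  -- The second starting point is chosen depending on `ε`, so close to `t` that the two orbits merge
  -- as `ε → ε₀`. This replaces equicontinuity of the lifts; one period of indices suffices.
  have hstep : ∀ ε, ∃ s, IsResonant (γ ε) m n (F ε) → ε ≠ ε₀ →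
      t < s ∧ ∀ i < n, |(F ε)^[i] s - (F ε)^[i] t| < |ε - ε₀| := by
    intro ε
    by_cases hc : IsResonant (γ ε) m n (F ε) ∧ ε ≠ ε₀
    · have hev : ∀ᶠ s in 𝓝 t, ∀ i ∈ Finset.range n,
          |(F ε)^[i] s - (F ε)^[i] t| < |ε - ε₀| := by
        rw [Filter.eventually_all_finset]
        intro i _
        have := Metric.continuousAt_iff'.1 ((hc.1.continuous.iterate i).continuousAt (x := t))
          (|ε - ε₀|) (abs_pos.2 (sub_ne_zero.2 hc.2))
        simpa only [Real.dist_eq] using this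
      obtain ⟨s, hs, hts⟩ := ((hev.filter_mono nhdsWithin_le_nhds).and
        (self_mem_nhdsWithin (s := Ioi t))).exists
      exact ⟨s, fun _ _ => ⟨hts, fun i hi => hs i (Finset.mem_range.2 hi)⟩⟩
    · exact ⟨t, fun h1 h2 => (hc ⟨h1, h2⟩).elim⟩
  choose s hs using hstep
  set δ : ℝ → ℕ → ℝ := fun ε i => (F ε)^[i] (s ε) - (F ε)^[i] t with hδ
  have hδpos : ∀ᶠ ε in U, ∀ i, 0 < δ ε i := by
    filter_upwards [hF, hUne] with ε h1 h2 i
    exact sub_pos.2 ((h1.strictMono hn).iterate i (hs ε h1 h2).1)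
  have hδper : ∀ᶠ ε in U, Function.Periodic (δ ε) n := by
    filter_upwards [hF] with ε h1 i
    simp only [hδ, h1.iterate_period]
    ring
  have hδlim : ∀ i, Tendsto (fun ε => δ ε i) U (𝓝 0) := by
    intro i
    have h0 : Tendsto (fun ε : ℝ => |ε - ε₀|) U (𝓝 0) := by
      simpa using (hUid.sub_const ε₀).abs
    refine squeeze_zero_norm' ?_ h0
    filter_upwards [hF, hUne, hδper] with ε h1 h2 h3
    rw [← h3.map_mod_nat i, Real.norm_eq_abs]
    exact ((hs ε h1 h2).2 _ (Nat.mod_lt i hn)).le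
  -- Normalizing by the sum over a period bounds the differences by `1` and keeps their limit
  -- nonzero.
  set N : ℝ → ℝ := fun ε => ∑ i ∈ Finset.range n, δ ε i with hN
  have hNpos : ∀ᶠ ε in U, 0 < N ε := by
    filter_upwards [hδpos] with ε h1
    exact Finset.sum_pos (fun i _ => h1 i) ⟨0, Finset.mem_range.2 hn⟩
  have hex : ∀ i, ∃ x, Tendsto (fun ε => (N ε)⁻¹ * δ ε i) U (𝓝 x) := by
    intro i
    have hmem : ∀ᶠ ε in U, (N ε)⁻¹ * δ ε i ∈ Icc (0 : ℝ) 1 := by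
      filter_upwards [hδpos, hδper, hNpos] with ε h1 h2 h3
      refine ⟨mul_nonneg (inv_nonneg.2 h3.le) (h1 i).le, ?_⟩
      rw [inv_mul_le_one₀ h3, ← h2.map_mod_nat i]
      exact Finset.single_le_sum (f := δ ε) (fun j _ => (h1 j).le)
        (Finset.mem_range.2 (Nat.mod_lt i hn))
    obtain ⟨x, -, hx⟩ := (isCompact_Icc (a := (0 : ℝ)) (b := 1)).ultrafilter_le_nhds
      (U.map fun ε => (N ε)⁻¹ * δ ε i) (le_principal_iff.2 hmem)
    exact ⟨x, hx⟩
  choose ξ hξ using hex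
  have hξ0 : ∀ i, 0 ≤ ξ i := fun i => by
    refine ge_of_tendsto (hξ i) ?_
    filter_upwards [hδpos, hNpos] with ε h1 h3
    exact mul_nonneg (inv_nonneg.2 h3.le) (h1 i).le
  have hξper : Function.Periodic ξ n := fun i => by
    refine tendsto_nhds_unique (hξ (i + n)) ((hξ i).congr' ?_)
    filter_upwards [hδper] with ε h1
    rw [h1]
  have hξsum : ∑ i ∈ Finset.range n, ξ i = 1 := by
    refine tendsto_nhds_unique (tendsto_finsetSum _ fun i _ => hξ i)
      (tendsto_const_nhds.congr' ?_)
    filter_upwards [hNpos] with ε h3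
    rw [← Finset.mul_sum, inv_mul_cancel₀ h3.ne']
  have hjac : ∀ i, fderiv ℝ (bounceDefect γ) (ε₀, T i, T (i + 1), T (i + 2))
      (0, ξ i, ξ (i + 1), ξ (i + 2)) = 0 := by
    intro i
    have hlim' : ∀ j, Tendsto (fun ε => (F ε)^[j] (s ε)) U (𝓝 (T j)) := fun j => by
      simpa [hδ] using (hδlim j).add (hlim j)
    have hzero : ∀ᶠ ε in U, ∀ r, bounceDefect γ
        (ε, (F ε)^[i] r, (F ε)^[i + 1] r, (F ε)^[i + 2] r) = 0 := by
      filter_upwards [hF] with ε h1 r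
      rw [Function.iterate_succ_apply' (F ε) (i + 1), Function.iterate_succ_apply' (F ε) i]
      exact h1.bounce _
    -- Both orbits belong to the same `ε`, so the limit direction has zero parameter component.
    refine (h.hasStrictFDerivAt_bounceDefect (p := (ε₀, T i, T (i + 1), T (i + 2)))
      hε).apply_eq_zero_of_tendsto (l := (U : Filter ℝ)) (c := fun ε => (N ε)⁻¹)
      (hUid.prodMk_nhds ((hlim' i).prodMk_nhds ((hlim' (i + 1)).prodMk_nhds (hlim' (i + 2)))))
      (hUid.prodMk_nhds ((hlim i).prodMk_nhds ((hlim (i + 1)).prodMk_nhds (hlim (i + 2)))))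
      ?_ ?_
    · filter_upwards [hzero] with ε h1
      rw [h1, h1]
    · simp only [Prod.mk_sub_mk, Prod.smul_mk, sub_self, smul_eq_mul, mul_zero]
      exact tendsto_const_nhds.prodMk_nhds
        ((hξ i).prodMk_nhds ((hξ (i + 1)).prodMk_nhds (hξ (i + 2))))
  refine ⟨ξ, nonneg_jacobi_pos hn (b := fun i => area (deriv (γ ε₀) (T i))
    (deriv (γ ε₀) (T (i + 1)))) (a := fun i => fderiv ℝ (bounceDefect γ)
      (ε₀, T i, T (i + 1), T (i + 2)) (0, 0, 1, 0)) (hT.area_deriv_pos hσ) hξ0 hξper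
    (fun i => ?_) (by rw [hξsum]; exact one_ne_zero), hjac⟩
  rw [← h.fderiv_bounceDefect hε, hjac]

/-! ### Local parametrization of the periodic orbits -/

lemma exists_analytic_inverse {V : Type*} [NormedAddCommGroup V] [NormedSpace ℝ V]
    [FiniteDimensional ℝ V] {Ψ : V → V} {p : V} (h : AnalyticAt ℝ Ψ p)
    (hinj : ∀ v, fderiv ℝ Ψ p v = 0 → v = 0) :
    ∃ e : OpenPartialHomeomorph V V, ⇑e = Ψ ∧ p ∈ e.source ∧ AnalyticAt ℝ e.symm (Ψ p) := by
  have : CompleteSpace V := FiniteDimensional.complete ℝ V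
  set D := (LinearEquiv.ofInjectiveEndo (fderiv ℝ Ψ p : V →ₗ[ℝ] V)
    ((injective_iff_map_eq_zero _).2 hinj)).toContinuousLinearEquiv
  have hD : (D : V →L[ℝ] V) = fderiv ℝ Ψ p := by
    ext v; rfl
  have hs : HasStrictFDerivAt Ψ (D : V →L[ℝ] V) p := hD ▸ h.hasStrictFDerivAt
  refine ⟨hs.toOpenPartialHomeomorph Ψ, hs.toOpenPartialHomeomorph_coe,
    hs.mem_toOpenPartialHomeomorph_source, ?_⟩
  have := (hs.toOpenPartialHomeomorph Ψ).analyticAt_symm' (i := D)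
    hs.mem_toOpenPartialHomeomorph_source
    (by rw [hs.toOpenPartialHomeomorph_coe]; exact h)
    (by rw [hs.toOpenPartialHomeomorph_coe]; exact hD.symm)
  rwa [hs.toOpenPartialHomeomorph_coe] at this

/-- The `i`-th coordinate, as a linear form, for `i ≤ n`; zero for `i > n`. -/
noncomputable def coordCLM (n i : ℕ) : (Fin (n + 1) → ℝ) →L[ℝ] ℝ :=
  if h : i < n + 1 then ContinuousLinearMap.proj ⟨i, h⟩ else 0

lemma coordCLM_apply {n i : ℕ} (h : i < n + 1) (x : Fin (n + 1) → ℝ) :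
    coordCLM n i x = x ⟨i, h⟩ := by
  simp [coordCLM, h]

lemma coordCLM_fin {n : ℕ} (j : Fin (n + 1)) (x : Fin (n + 1) → ℝ) :
    coordCLM n j x = x j := coordCLM_apply j.2 x

/-- The parameters and the three consecutive coordinates from the `i`-th on. -/
noncomputable def tripleCLM (n i : ℕ) : (ℝ × (Fin (n + 1) → ℝ)) →L[ℝ] ℝ × ℝ × ℝ × ℝ :=
  (ContinuousLinearMap.fst ℝ _ _).prod
    (((coordCLM n i).comp (ContinuousLinearMap.snd ℝ _ _)).prod
      (((coordCLM n (i + 1)).comp (ContinuousLinearMap.snd ℝ _ _)).prod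
        ((coordCLM n (i + 2)).comp (ContinuousLinearMap.snd ℝ _ _))))

lemma tripleCLM_apply (n i : ℕ) (p : ℝ × (Fin (n + 1) → ℝ)) : tripleCLM n i p =
    (p.1, coordCLM n i p.2, coordCLM n (i + 1) p.2, coordCLM n (i + 2) p.2) := rfl

/-- The map whose fibres over the points `(ε, (t, 0, …, 0, s))` are the orbit segments from `t`
to `s` of the billiard with parameter `ε`. -/
noncomputable def segmentMap (γ : ℝ → ℝ → Plane) (n : ℕ) (p : ℝ × (Fin (n + 1) → ℝ)) :
    ℝ × (Fin (n + 1) → ℝ) :=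
  (p.1, fun j => if (j : ℕ) = 0 ∨ (j : ℕ) = n then p.2 j
    else bounceDefect γ (tripleCLM n (j - 1) p))

lemma analyticAt_segmentMap (h : IsOvalFamily J γ) {p : ℝ × (Fin (n + 1) → ℝ)} (hp : p.1 ∈ J) :
    AnalyticAt ℝ (segmentMap γ n) p := by
  refine analyticAt_fst.prod (AnalyticAt.pi fun j => ?_)
  split_ifs
  · exact ((ContinuousLinearMap.proj (R := ℝ) (φ := fun _ : Fin (n + 1) => ℝ) j).comp
      (ContinuousLinearMap.snd ℝ ℝ (Fin (n + 1) → ℝ))).analyticAt p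
  · have hc := fun i => ((coordCLM n i).comp
      (ContinuousLinearMap.snd ℝ ℝ (Fin (n + 1) → ℝ))).analyticAt p
    exact h.analyticAt_bounceDefect analyticAt_fst (hc _) (hc _) (hc _) hp

lemma fderiv_segmentMap_apply (h : IsOvalFamily J γ) {p : ℝ × (Fin (n + 1) → ℝ)} (hp : p.1 ∈ J)
    (v : ℝ × (Fin (n + 1) → ℝ)) : fderiv ℝ (segmentMap γ n) p v =
      (v.1, fun j : Fin (n + 1) => if (j : ℕ) = 0 ∨ (j : ℕ) = n then v.2 j
        else fderiv ℝ (bounceDefect γ) (tripleCLM n (j - 1) p) (tripleCLM n (j - 1) v)) := by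
  have hΨ := (analyticAt_segmentMap (n := n) h hp).differentiableAt.hasFDerivAt
  ext j
  · exact congrArg (fun L : (ℝ × (Fin (n + 1) → ℝ)) →L[ℝ] ℝ => L v)
      (((ContinuousLinearMap.fst ℝ ℝ (Fin (n + 1) → ℝ)).hasFDerivAt.comp p hΨ).unique
        (ContinuousLinearMap.fst ℝ ℝ (Fin (n + 1) → ℝ)).hasFDerivAt)
  · have h1 := ((ContinuousLinearMap.proj (R := ℝ) (φ := fun _ : Fin (n + 1) => ℝ) j).comp
      (ContinuousLinearMap.snd ℝ ℝ (Fin (n + 1) → ℝ))).hasFDerivAt.comp p hΨ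
    by_cases hj : (j : ℕ) = 0 ∨ (j : ℕ) = n
    · have h2 := ((ContinuousLinearMap.proj (R := ℝ) (φ := fun _ : Fin (n + 1) => ℝ) j).comp
        (ContinuousLinearMap.snd ℝ ℝ (Fin (n + 1) → ℝ))).hasFDerivAt (x := p)
      have := congrArg (fun L : (ℝ × (Fin (n + 1) → ℝ)) →L[ℝ] ℝ => L v)
        (h1.unique (h2.congr_of_eventuallyEq (Eventually.of_forall fun q => if_pos hj)))
      exact this.trans (if_pos hj).symm
    · have h2 := ((h.hasStrictFDerivAt_bounceDefect (p := tripleCLM n (j - 1) p)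
        hp).hasFDerivAt).comp p (tripleCLM n (j - 1)).hasFDerivAt
      have := congrArg (fun L : (ℝ × (Fin (n + 1) → ℝ)) →L[ℝ] ℝ => L v)
        (h1.unique (h2.congr_of_eventuallyEq (Eventually.of_forall fun q => if_neg hj)))
      exact this.trans (if_neg hj).symm

/-- Near a periodic orbit carrying a positive Jacobi field, the orbit segments from `t` to `t + m`
form an analytic graph over the parameters `(ε, t)`. -/
lemma exists_segment_graph (h : IsOvalFamily J γ) (hε : ε₀ ∈ J) (hn : 0 < n)
    (hT : IsPeriodicOrbit (γ ε₀) m n T) {ξ : ℕ → ℝ} (hξ : ∀ i, 0 < ξ i)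
    (hjac : ∀ i, fderiv ℝ (bounceDefect γ) (ε₀, T i, T (i + 1), T (i + 2))
        (0, ξ i, ξ (i + 1), ξ (i + 2)) = 0) :
    ∃ (V : Set (ℝ × (Fin (n + 1) → ℝ))) (Φ : ℝ × ℝ → Fin (n + 1) → ℝ), IsOpen V ∧
      (ε₀, fun i : Fin (n + 1) => T i) ∈ V ∧ AnalyticAt ℝ Φ (ε₀, T 0) ∧
      ∀ᶠ q in 𝓝 (ε₀, T 0), (q.1, Φ q) ∈ V ∧ ∀ x, (q.1, x) ∈ V → x 0 = q.2 →
        x (Fin.last n) = q.2 + m →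
        (∀ i, i + 2 ≤ n → bounceDefect γ (tripleCLM n i (q.1, x)) = 0) → x = Φ q := by
  obtain ⟨σ, hσ⟩ := h.oval ε₀ hε
  set p : ℝ × (Fin (n + 1) → ℝ) := (ε₀, fun i : Fin (n + 1) => T i)
  have htr : ∀ i, i + 2 ≤ n → tripleCLM n i p = (ε₀, T i, T (i + 1), T (i + 2)) := by
    intro i hi
    rw [tripleCLM_apply, coordCLM_apply (by omega), coordCLM_apply (by omega),
      coordCLM_apply (by omega)]
  -- A kernel vector is a Jacobi field vanishing at both ends with no variation of `ε`; disconjugacy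
  -- kills it.
  have hinj : ∀ v, fderiv ℝ (segmentMap γ n) p v = 0 → v = 0 := by
    rintro ⟨v1, v⟩ hv
    rw [fderiv_segmentMap_apply h (p := p) hε] at hv
    obtain ⟨h1, h2⟩ := Prod.ext_iff.1 hv
    simp only at h1 h2
    subst h1
    have h2 := fun j => congrFun h2 j
    have hη : ∀ i ≤ n, coordCLM n i v = 0 := by
      intro i hi
      refine jacobi_eq_zero (n := n) (η := fun i => coordCLM n i v)
        (b := fun i => area (deriv (γ ε₀) (T i)) (deriv (γ ε₀) (T (i + 1))))
        (a := fun i => fderiv ℝ (bounceDefect γ) (ε₀, T i, T (i + 1), T (i + 2)) (0, 0, 1, 0))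
        (hT.area_deriv_pos hσ) hξ (fun i => ?_) (fun i hi => ?_) ?_ ?_ hi
      · rw [← h.fderiv_bounceDefect hε, hjac]
      · have h3 := h2 ⟨i + 1, by omega⟩
        have h4 : ¬(i + 1 = 0 ∨ i + 1 = n) := by omega
        simp only [h4, if_false, Nat.add_sub_cancel] at h3
        rw [htr i hi, tripleCLM_apply] at h3
        rw [← h.fderiv_bounceDefect hε]
        exact h3
      · have h3 := h2 0
        simp only [Fin.val_zero, true_or, if_true] at h3
        simpa [coordCLM_apply (Nat.succ_pos n)] using h3
      · have h3 := h2 (Fin.last n)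
        simp only [Fin.val_last, or_true, if_true] at h3
        exact (coordCLM_apply (Nat.lt_succ_self n) v).trans h3
    ext j
    · rfl
    · have := hη j (Nat.lt_succ_iff.1 j.2)
      rwa [coordCLM_fin] at this
  obtain ⟨e, he, hpe, hsymm⟩ := exists_analytic_inverse (analyticAt_segmentMap h hε) hinj
  -- The value of `segmentMap` on an orbit segment from `t` to `t + m`: prescribed ends, zero defect
  -- at interior indices. The graph is the inverse map along `Q`.
  set Q : ℝ × ℝ → ℝ × (Fin (n + 1) → ℝ) := fun q =>
    (q.1, fun j => if (j : ℕ) = 0 then q.2 else if (j : ℕ) = n then q.2 + m else 0)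
  have hseg : ∀ {q : ℝ × ℝ} {x : Fin (n + 1) → ℝ}, x 0 = q.2 → x (Fin.last n) = q.2 + m →
      (∀ i, i + 2 ≤ n → bounceDefect γ (tripleCLM n i (q.1, x)) = 0) →
      segmentMap γ n (q.1, x) = Q q := by
    intro q x h0 h1 h2
    simp only [segmentMap, Q]
    congr 1
    ext j
    by_cases hj0 : (j : ℕ) = 0
    · have : j = 0 := Fin.ext hj0
      simp [this, h0]
    · by_cases hjn : (j : ℕ) = n
      · have : j = Fin.last n := Fin.ext hjn
        simp [this, h1, hn.ne']
      · have hlt := j.2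
        simp only [hj0, hjn, or_self, if_false]
        exact h2 _ (by omega)
  have hQp : Q (ε₀, T 0) = segmentMap γ n p := by
    refine (hseg (q := (ε₀, T 0)) (x := p.2) rfl ?_ fun i hi => ?_).symm
    · have := hT.period 0
      rw [zero_add] at this
      exact this
    · rw [show ((ε₀, T 0).1, p.2) = p from rfl, htr i hi]
      exact hT.bounce i
  have hQ : ∀ q, AnalyticAt ℝ Q q := by
    intro q
    refine analyticAt_fst.prod (AnalyticAt.pi fun j => ?_)
    split_ifs
    · exact analyticAt_snd
    · exact analyticAt_snd.add analyticAt_const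
    · exact analyticAt_const
  have hcomp : AnalyticAt ℝ (fun q => e.symm (Q q)) (ε₀, T 0) :=
    AnalyticAt.comp (by rw [hQp]; exact hsymm) (hQ _)
  refine ⟨e.source, fun q => (e.symm (Q q)).2, e.open_source, hpe, analyticAt_snd.comp hcomp, ?_⟩
  have htgt : ∀ᶠ q in 𝓝 (ε₀, T 0), Q q ∈ e.target := by
    refine (hQ _).continuousAt.eventually_mem (e.open_target.mem_nhds ?_)
    rw [hQp, ← he]
    exact e.map_source hpe
  filter_upwards [htgt] with q hq
  refine ⟨?_, fun x hx h0 h1 h2 => ?_⟩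
  · have h1 : (e.symm (Q q)).1 = q.1 := by
      have := congrArg Prod.fst (e.right_inv hq)
      rw [he] at this
      exact this
    rw [← h1]
    exact e.map_target hq
  · rw [← hseg h0 h1 h2, ← he, e.left_inv hx]

end Family

end SymplecticBilliard

namespace SymplecticBilliard

section Family

variable {J : Set ℝ} {γ : ℝ → ℝ → Plane} {ε₀ : ℝ} {U : Ultrafilter ℝ} {m : ℤ} {n : ℕ}
  {F : ℝ → ℝ → ℝ}

/-! ### Analytic continuation of the invariant curves -/

/-- Resonant orbits are segments from `s` to `s + m`, so as long as they stay in the uniqueness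
neighbourhood `V` they coincide with the analytic graph; the lift is its coordinate of index `1`. -/
lemma exists_local_lift (h : IsOvalFamily J γ) (hε : ε₀ ∈ J) (hU : (U : Filter ℝ) ≤ 𝓝[≠] ε₀)
    (hn : 0 < n) (hm : 0 < m) (hF : ∀ᶠ ε in U, IsResonant (γ ε) m n (F ε)) (t : ℝ) :
    ∃ r > 0, ∃ φ : ℝ × ℝ → ℝ,
      AnalyticOnNhd ℝ φ (Metric.ball ε₀ r ×ˢ Metric.ball t r) ∧
      ∀ᶠ ε in U, ∀ s ∈ Metric.ball t r, F ε s = φ (ε, s) := by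
  obtain ⟨σ, hσ⟩ := h.oval ε₀ hε
  have hUid : Tendsto (fun ε : ℝ => ε) U (𝓝 ε₀) := hU.trans nhdsWithin_le_nhds
  obtain ⟨T, rfl, hlim, hT⟩ := exists_tendsto_iterate hn hm hσ
    (h.curveTendsto hε (hU.trans nhdsWithin_le_nhds)) hF t
  obtain ⟨ξ, hξ, hjac⟩ := exists_pos_jacobi h hε hU hn hF hlim hT
  obtain ⟨V, Φ, hV, hTV, hΦ, hev⟩ := exists_segment_graph h hε hn hT hξ hjac
  obtain ⟨r, hr, hball⟩ := Metric.eventually_nhds_iff_ball.1 (hΦ.eventually_analyticAt.and hev)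
  rw [← ball_prod_same] at hball
  refine ⟨r, hr, fun q => Φ q ⟨1, by omega⟩, fun q hq => ?_, ?_⟩
  · exact (ContinuousLinearMap.proj (R := ℝ) (φ := fun _ : Fin (n + 1) => ℝ)
      ⟨1, by omega⟩).analyticAt _ |>.comp (hball q hq).1
  set X : ℝ → ℝ → Fin (n + 1) → ℝ := fun ε s i => (F ε)^[i] s
  have hXV : ∀ᶠ ε in U, (ε, X ε (T 0)) ∈ V :=
    (hUid.prodMk_nhds (tendsto_pi_nhds.2 fun i : Fin (n + 1) => hlim i)).eventually_mem
      (hV.mem_nhds hTV)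
  filter_upwards [hF, hXV, hUid.eventually_mem (Metric.ball_mem_nhds ε₀ hr)] with ε h1 h2 h3
  have hXc : Continuous (X ε) := continuous_pi fun i => h1.continuous.iterate i
  set A : Set ℝ := {s | (ε, X ε s) ∈ V}
  have hAo : IsOpen A := hV.preimage (continuous_const.prodMk hXc)
  have hA : ∀ s ∈ A, s ∈ Metric.ball (T 0) r → X ε s = Φ (ε, s) := by
    intro s hsA hs
    refine (hball (ε, s) ⟨h3, hs⟩).2.2 (X ε s) hsA rfl (h1.iterate s) fun i hi => ?_
    rw [tripleCLM_apply, coordCLM_apply (by omega), coordCLM_apply (by omega),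
      coordCLM_apply (by omega)]
    simp only [X]
    rw [Function.iterate_succ_apply' (F ε) (i + 1), Function.iterate_succ_apply' (F ε) i]
    exact h1.bounce _
  -- Convergence is known only at the centre. On the ball, `A` is open and also relatively closed,
  -- since a limit of segments on the graph is on the graph and hence in `V`; connectedness then
  -- gives the whole ball.
  have hsub : Metric.ball (T 0) r ⊆ A := by
    refine (convex_ball (T 0) r).isPreconnected.subset_of_closure_inter_subset hAo
      ⟨T 0, Metric.mem_ball_self hr, h2⟩ ?_
    rintro s ⟨hsA, hs⟩
    have hΦc : ContinuousAt (fun s => Φ (ε, s)) s :=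
      (hball (ε, s) ⟨h3, hs⟩).1.continuousAt.comp (by fun_prop : ContinuousAt (Prod.mk ε) s)
    have hfreq : ∃ᶠ s' in 𝓝 s, X ε s' = Φ (ε, s') :=
      ((mem_closure_iff_frequently.1 hsA).and_eventually
        (Metric.isOpen_ball.mem_nhds hs)).mono fun s' h' => hA s' h'.1 h'.2
    have := tendsto_nhds_unique_of_frequently_eq (hXc.tendsto s) hΦc hfreq
    change (ε, X ε s) ∈ V
    rw [this]
    exact (hball (ε, s) ⟨h3, hs⟩).2.1
  intro s hs
  exact congrFun (hA s (hsub hs) hs) ⟨1, by omega⟩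

/-- Compactness of `[0, 1]` and commutation with integer translations make the radius in `ε` and the
set of parameters independent of `t`. -/
lemma exists_uniform_local_lift (h : IsOvalFamily J γ) (hε : ε₀ ∈ J)
    (hU : (U : Filter ℝ) ≤ 𝓝[≠] ε₀)
    (hn : 0 < n) (hm : 0 < m) (hF : ∀ᶠ ε in U, IsResonant (γ ε) m n (F ε)) :
    ∃ r > 0, ∃ A ∈ U, ∀ t, ∃ ρ > 0, ∃ φ : ℝ × ℝ → ℝ,
      AnalyticOnNhd ℝ φ (Metric.ball ε₀ r ×ˢ Metric.ball t ρ) ∧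
      ∀ ε ∈ A, ∀ s ∈ Metric.ball t ρ, F ε s = φ (ε, s) := by
  have hcomp : ∃ r > 0, ∃ A ∈ U, ∀ t ∈ Icc (0 : ℝ) 1, ∃ ρ > 0, ∃ φ : ℝ × ℝ → ℝ,
      AnalyticOnNhd ℝ φ (Metric.ball ε₀ r ×ˢ Metric.ball t ρ) ∧
      ∀ ε ∈ A, ∀ s ∈ Metric.ball t ρ, F ε s = φ (ε, s) := by
    refine isCompact_Icc.induction_on (p := fun K => ∃ r > 0, ∃ A ∈ U, ∀ t ∈ K, ∃ ρ > 0,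
      ∃ φ : ℝ × ℝ → ℝ, AnalyticOnNhd ℝ φ (Metric.ball ε₀ r ×ˢ Metric.ball t ρ) ∧
      ∀ ε ∈ A, ∀ s ∈ Metric.ball t ρ, F ε s = φ (ε, s)) ?_ ?_ ?_ ?_
    · exact ⟨1, one_pos, univ, univ_mem, fun t ht => ht.elim⟩
    · rintro K K' hKK ⟨r, hr, A, hA, hK⟩
      exact ⟨r, hr, A, hA, fun t ht => hK t (hKK ht)⟩
    · rintro K K' ⟨r, hr, A, hA, hK⟩ ⟨r', hr', A', hA', hK'⟩
      refine ⟨min r r', lt_min hr hr', A ∩ A', inter_mem hA hA', ?_⟩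
      rintro t (ht | ht)
      · obtain ⟨ρ, hρ, φ, h1, h2⟩ := hK t ht
        exact ⟨ρ, hρ, φ, h1.mono (prod_mono (Metric.ball_subset_ball (min_le_left _ _)) le_rfl),
          fun ε hε => h2 ε hε.1⟩
      · obtain ⟨ρ, hρ, φ, h1, h2⟩ := hK' t ht
        exact ⟨ρ, hρ, φ, h1.mono (prod_mono (Metric.ball_subset_ball (min_le_right _ _)) le_rfl),
          fun ε hε => h2 ε hε.2⟩
    · intro t _
      obtain ⟨r, hr, φ, h1, h2⟩ := exists_local_lift h hε hU hn hm hF t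
      refine ⟨Metric.ball t (r / 2), mem_nhdsWithin_of_mem_nhds
        (Metric.ball_mem_nhds t (half_pos hr)), r, hr, _, h2, fun s hs => ?_⟩
      have hsub : Metric.ball s (r / 2) ⊆ Metric.ball t r :=
        Metric.ball_subset_ball' (by rw [Metric.mem_ball] at hs; linarith)
      exact ⟨r / 2, half_pos hr, φ, h1.mono (prod_mono le_rfl hsub),
        fun ε hε s' hs' => hε s' (hsub hs')⟩
  obtain ⟨r, hr, A, hA, hK⟩ := hcomp
  refine ⟨r, hr, A ∩ {ε | IsResonant (γ ε) m n (F ε)}, inter_mem hA hF, fun t => ?_⟩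
  obtain ⟨ρ, hρ, φ, h1, h2⟩ := hK (Int.fract t) ⟨Int.fract_nonneg t, (Int.fract_lt_one t).le⟩
  have hball : ∀ s ∈ Metric.ball t ρ, s - ⌊t⌋ ∈ Metric.ball (Int.fract t) ρ := by
    intro s hs
    rw [Metric.mem_ball, Real.dist_eq] at hs ⊢
    rw [← Int.self_sub_floor]
    convert hs using 2
    ring
  refine ⟨ρ, hρ, fun q => φ (q.1, q.2 - ⌊t⌋) + ⌊t⌋, fun q hq => ?_, fun ε hε s hs => ?_⟩
  · exact (AnalyticAt.comp (g := φ) (f := fun q : ℝ × ℝ => (q.1, q.2 - (⌊t⌋ : ℝ)))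
      (h1 _ ⟨hq.1, hball _ hq.2⟩)
      (analyticAt_fst.prod (analyticAt_snd.sub analyticAt_const))).add analyticAt_const
  · simp only
    rw [← h2 ε hε.1 _ (hball s hs)]
    have := hε.2.iterate_add_int 1 (s - ⌊t⌋) ⌊t⌋
    simpa using this

/-- If the parameters with an `(m, n)`-periodic invariant curve accumulate at `ε₀`, then these
curves extend to an analytic family near `ε₀`. -/
lemma exists_analytic_lift (h : IsOvalFamily J γ) (hε : ε₀ ∈ J)
    (hU : (U : Filter ℝ) ≤ 𝓝[≠] ε₀)
    (hn : 0 < n) (hm : 0 < m) (hF : ∀ᶠ ε in U, IsResonant (γ ε) m n (F ε)) :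
    ∃ r > 0, ∃ f : ℝ × ℝ → ℝ, AnalyticOnNhd ℝ f (Metric.ball ε₀ r ×ˢ univ) ∧
      ∀ᶠ ε in U, ∀ t, F ε t = f (ε, t) := by
  obtain ⟨r, hr, A, hA, hloc⟩ := exists_uniform_local_lift h hε hU hn hm hF
  choose ρ hρ φ hφ hφF using hloc
  have hfreq : ∃ᶠ ε in 𝓝[≠] ε₀, ε ∈ A := (Eventually.frequently hA).filter_mono hU
  -- For fixed `s` both sides are analytic in `ε` and equal `F ε s` on `A`, which accumulates at
  -- `ε₀`; the identity theorem in the single variable `ε` glues the local lifts.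
  have heq : ∀ t, ∀ s ∈ Metric.ball t (ρ t), ∀ ε ∈ Metric.ball ε₀ r,
      φ s (ε, s) = φ t (ε, s) := by
    intro t s hs
    have hline : ∀ {t'}, s ∈ Metric.ball t' (ρ t') →
        AnalyticOnNhd ℝ (fun ε => φ t' (ε, s)) (Metric.ball ε₀ r) := fun hs' ε hε =>
      AnalyticAt.comp (g := φ _) (f := fun ε => (ε, s)) (hφ _ (ε, s) ⟨hε, hs'⟩)
        (analyticAt_id.prod analyticAt_const)
    have hss := Metric.mem_ball_self (x := s) (hρ s)
    exact (hline hss).eqOn_of_preconnected_of_frequently_eq (hline hs)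
      (convex_ball ε₀ r).isPreconnected (Metric.mem_ball_self hr)
      (hfreq.mono fun ε hεA => by rw [← hφF s ε hεA s hss, ← hφF t ε hεA s hs])
  refine ⟨r, hr, fun q => φ q.2 q, ?_, ?_⟩
  · rintro ⟨ε, t⟩ ⟨hε', -⟩
    have ht := Metric.mem_ball_self (x := t) (hρ t)
    refine (hφ t (ε, t) ⟨hε', ht⟩).congr ?_
    filter_upwards [(Metric.isOpen_ball.prod Metric.isOpen_ball).mem_nhds
      (show (ε, t) ∈ Metric.ball ε₀ r ×ˢ Metric.ball t (ρ t) from ⟨hε', ht⟩)] with q hq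
    exact (heq t q.2 hq.2 q.1 hq.1).symm
  · filter_upwards [hA] with ε hεA t
    exact hφF t ε hεA t (Metric.mem_ball_self (hρ t))

/-- A resonance with an accumulation point is locally persistent. -/
theorem eventually_hasPeriodicInvariantCurve (h : IsOvalFamily J γ) (hε : ε₀ ∈ J)
    (hn : 0 < n) (hm : 0 < m)
    (hfreq : ∃ᶠ ε in 𝓝[≠] ε₀, HasPeriodicInvariantCurve (γ ε) m n) :
    ∀ᶠ ε in 𝓝 ε₀, HasPeriodicInvariantCurve (γ ε) m n := by
  have hex : ∀ ε, ∃ f, ε ∈ J → HasPeriodicInvariantCurve (γ ε) m n →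
      IsResonant (γ ε) m n f := by
    intro ε
    by_cases hc : ε ∈ J ∧ HasPeriodicInvariantCurve (γ ε) m n
    · obtain ⟨σ, hσ⟩ := h.oval ε hc.1
      obtain ⟨f, hf⟩ := hc.2.exists_isResonant hσ
      exact ⟨f, fun _ _ => hf⟩
    · exact ⟨id, fun h1 h2 => (hc ⟨h1, h2⟩).elim⟩
  choose F hF using hex
  have hne := frequently_iff_neBot.1 hfreq
  set U := Ultrafilter.of (𝓝[≠] ε₀ ⊓ 𝓟 {ε | HasPeriodicInvariantCurve (γ ε) m n})
  have hUle := Ultrafilter.of_le (𝓝[≠] ε₀ ⊓ 𝓟 {ε | HasPeriodicInvariantCurve (γ ε) m n})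
  have hU : (U : Filter ℝ) ≤ 𝓝[≠] ε₀ := hUle.trans inf_le_left
  have hUid : Tendsto (fun ε : ℝ => ε) U (𝓝 ε₀) := hU.trans nhdsWithin_le_nhds
  have hUF : ∀ᶠ ε in U, IsResonant (γ ε) m n (F ε) := by
    filter_upwards [hUle (mem_inf_of_right (mem_principal_self _)),
      hUid.eventually_mem (h.isOpen.mem_nhds hε)] with ε h1 h2 using hF ε h2 h1
  obtain ⟨r₁, hr₁, f, hf₁, hfF⟩ := exists_analytic_lift h hε hU hn hm hUF
  obtain ⟨r₂, hr₂, hJ⟩ := Metric.isOpen_iff.1 h.isOpen ε₀ hε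
  set r := min r₁ r₂
  have hr : 0 < r := lt_min hr₁ hr₂
  set B := Metric.ball ε₀ r
  have hBJ : B ⊆ J := (Metric.ball_subset_ball (min_le_right _ _)).trans hJ
  have hf : ∀ ε ∈ B, ∀ t, AnalyticAt ℝ f (ε, t) := fun ε hε t =>
    hf₁ (ε, t) ⟨Metric.ball_subset_ball (min_le_left _ _) hε, mem_univ _⟩
  -- The continuation principle: an analytic identity valid for almost all `ε` along `U` holds on
  -- the whole ball.
  have hid : ∀ {u v : ℝ → ℝ}, AnalyticOnNhd ℝ u B → AnalyticOnNhd ℝ v B →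
      (∀ᶠ ε in U, u ε = v ε) → ∀ ε ∈ B, u ε = v ε := fun hu hv huv =>
    hu.eqOn_of_preconnected_of_frequently_eq hv (convex_ball ε₀ r).isPreconnected
      (Metric.mem_ball_self hr) ((Eventually.frequently huv).filter_mono hU)
  have hcomp : ∀ {u : ℝ → ℝ}, AnalyticOnNhd ℝ u B → AnalyticOnNhd ℝ (fun ε => f (ε, u ε)) B :=
    fun hu ε hε => AnalyticAt.comp (g := f) (hf ε hε _) (analyticAt_id.prod (hu ε hε))
  have hconst : ∀ t : ℝ, AnalyticOnNhd ℝ (fun _ : ℝ => t) B := fun t _ _ => analyticAt_const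
  have hfF' : ∀ᶠ ε in U, (fun t => f (ε, t)) = F ε :=
    hfF.mono fun ε h1 => funext fun t => (h1 t).symm
  have hadd : ∀ ε ∈ B, ∀ t, f (ε, t + 1) = f (ε, t) + 1 := fun ε hεB t => by
    refine hid (hcomp (hconst (t + 1))) ((hcomp (hconst t)).add (hconst 1)) ?_ ε hεB
    filter_upwards [hUF, hfF] with ε' h1 h2
    simp only [Pi.add_apply]
    rw [← h2, ← h2, h1.add_one]
  have hiter : ∀ ε ∈ B, ∀ t, (fun t => f (ε, t))^[n] t = t + m := fun ε hεB t => by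
    have han : ∀ k : ℕ, AnalyticOnNhd ℝ (fun ε => (fun t => f (ε, t))^[k] t) B := by
      intro k
      induction k with
      | zero => exact hconst t
      | succ k ih =>
        simp only [Function.iterate_succ_apply']
        exact hcomp ih
    refine hid (han n) (hconst (t + m)) ?_ ε hεB
    filter_upwards [hUF, hfF'] with ε' h1 h2
    rw [h2, h1.iterate]
  have hbounce : ∀ ε ∈ B, ∀ t, bounceDefect γ (ε, t, f (ε, t), f (ε, f (ε, t))) = 0 := by
    intro ε hεB t
    refine hid (u := fun ε => bounceDefect γ (ε, t, f (ε, t), f (ε, f (ε, t))))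
      (fun ε hε => h.analyticAt_bounceDefect analyticAt_id analyticAt_const
        (hcomp (hconst t) ε hε) (hcomp (hcomp (hconst t)) ε hε) (hBJ hε)) (hconst 0) ?_ ε hεB
    filter_upwards [hUF, hfF] with ε' h1 h2
    rw [← h2, ← h2]
    exact h1.bounce t
  obtain ⟨σ₀, hσ₀⟩ := h.oval ε₀ hε
  -- Strict inequalities do not continue analytically; at `ε₀` they come from nondegeneracy of the
  -- limit orbit, and nearby from openness and compactness of `[0, 1]`.
  have hphase₀ : ∀ t, t < f (ε₀, t) ∧ f (ε₀, t) < star (γ ε₀) t := by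
    intro t
    obtain ⟨T, rfl, hlim, hT⟩ := exists_tendsto_iterate hn hm hσ₀ (h.curveTendsto hε hUid) hUF t
    have h1 : Tendsto (fun ε => F ε (T 0)) U (𝓝 (f (ε₀, T 0))) := by
      refine (((hf ε₀ (Metric.mem_ball_self hr) (T 0)).continuousAt.tendsto).comp
        (hUid.prodMk_nhds tendsto_const_nhds)).congr' ?_
      filter_upwards [hfF] with ε' h2 using (h2 _).symm
    rw [tendsto_nhds_unique h1 (hlim 1)]
    exact ⟨hT.lt 0, hT.lt_star 0⟩
  have hphase : ∀ᶠ ε in 𝓝 ε₀, ∀ t ∈ Icc (0 : ℝ) 1, t < f (ε, t) ∧ f (ε, t) < star (γ ε) t := by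
    refine isCompact_Icc.eventually_forall_of_forall_eventually fun t _ => ?_
    have hfc := (hf ε₀ (Metric.mem_ball_self hr) t).continuousAt
    exact (continuousAt_snd.eventually_lt hfc (hphase₀ t).1).and
      (hfc.eventually_lt (h.continuousAt_star hε) (hphase₀ t).2)
  filter_upwards [hphase, Metric.ball_mem_nhds ε₀ hr] with ε hph hεB
  obtain ⟨σ, hσ⟩ := h.oval ε (hBJ hεB)
  have hfan : ∀ t, AnalyticAt ℝ (fun t => f (ε, t)) t := fun t =>
    AnalyticAt.comp (g := f) (f := fun t => (ε, t)) (hf ε hεB t)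
      (analyticAt_const.prod analyticAt_id)
  have hph' : ∀ t, t < f (ε, t) ∧ f (ε, t) < star (γ ε) t := by
    intro t
    have h1 := hph (Int.fract t) ⟨Int.fract_nonneg t, (Int.fract_lt_one t).le⟩
    have hper : Function.Periodic (fun t => f (ε, t) - t) 1 := fun t => by
      simp only [hadd ε hεB]; ring
    have h2 := hper.int_mul ⌊t⌋ (Int.fract t)
    have h3 := hσ.star_add_int (Int.fract t) ⌊t⌋
    simp only [mul_one] at h2
    rw [Int.fract_add_floor] at h2 h3
    have h4 := Int.fract_add_floor t
    constructor
    · linarith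
    · linarith
  refine IsResonant.hasPeriodicInvariantCurve (f := fun t => f (ε, t)) hσ
    ⟨continuous_iff_continuousAt.2 fun t => (hfan t).continuousAt, hadd ε hεB,
      fun t => (hph' t).1, fun t => (hph' t).2, hbounce ε hεB, hiter ε hεB⟩ ?_
  refine contDiff_iff_contDiffAt.2 fun t => AnalyticAt.contDiffAt ?_
  exact (h.analyticAt_deriv analyticAt_const analyticAt_id (hBJ hεB)).area
    (h.analyticAt analyticAt_const (hfan t) (hBJ hεB))

end Family

/-! ### Reparametrization near a point of the interval -/

section Interval

variable {I : Set ℝ} {Ω : ℝ → Set Plane} {γ : ℝ → ℝ → Plane} {m : ℤ} {n : ℕ}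

/-- Analyticity on `I × ℝ` is only relative to that set; pulling back to an open `J` makes it
analyticity on neighbourhoods, including over an endpoint of `I`. -/
lemma IsAnalyticFamily.isOvalFamily_comp (hΩ : IsAnalyticFamily I Ω γ) {J : Set ℝ}
    (hJ : IsOpen J) {e : ℝ → ℝ} (he : ∀ δ, AnalyticAt ℝ e δ) (heI : MapsTo e J I) :
    IsOvalFamily J fun δ => γ (e δ) := by
  have han : AnalyticOnNhd ℝ (fun x : ℝ × ℝ => γ (e x.1) x.2) (J ×ˢ univ) := by
    rw [← (hJ.prod isOpen_univ).analyticOn_iff_analyticOnNhd]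
    exact AnalyticOn.comp (f := fun x : ℝ × ℝ => γ x.1 x.2) (g := fun x : ℝ × ℝ => (e x.1, x.2))
      hΩ.analytic (fun x _ => ((AnalyticAt.comp (g := e) (he x.1) analyticAt_fst).prod
        analyticAt_snd).analyticWithinAt) fun x hx => ⟨heI hx.1, mem_univ _⟩
  refine ⟨hJ, han, fun δ hδ => exists_isOval (hΩ.domain _ (heI hδ)) (hΩ.param _ (heI hδ)) ?_⟩
  refine continuous_iff_continuousAt.2 fun t => ?_
  exact (analyticOnNhd_deriv (γ := fun δ => γ (e δ)) hJ han (δ, t)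
    ⟨hδ, mem_univ _⟩).continuousAt.comp (f := fun t => (δ, t)) (by fun_prop)

/-- A nondegenerate interval has, near each of its points, an analytic parametrization by an open
set of parameters; at an endpoint the parametrization is a fold. -/
lemma exists_analytic_chart (hI : I.OrdConnected) {β x : ℝ} (hβ : β ∈ I) (hx : x ∈ I)
    (hne : x ≠ β) :
    ∃ (J : Set ℝ) (e s : ℝ → ℝ), IsOpen J ∧ (0 : ℝ) ∈ J ∧ (∀ δ, AnalyticAt ℝ e δ) ∧ MapsTo e J I ∧
      e 0 = β ∧ ContinuousAt s β ∧ s β = 0 ∧ ∀ ε ∈ I, e (s ε) = ε := by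
  by_cases hnhds : I ∈ 𝓝 β
  · refine ⟨(fun δ => β + δ) ⁻¹' interior I, fun δ => β + δ, fun ε => ε - β,
      isOpen_interior.preimage (by fun_prop), ?_, fun δ => analyticAt_const.add analyticAt_id,
      fun δ hδ => interior_subset hδ, by simp, by fun_prop, by simp, fun ε _ => by ring⟩
    simpa using mem_interior_iff_mem_nhds.2 hnhds
  have hside : (∀ y ∈ I, β ≤ y) ∨ ∀ y ∈ I, y ≤ β := by
    by_contra hcon
    push Not at hcon
    obtain ⟨⟨a, ha, haβ⟩, b, hb, hbβ⟩ := hcon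
    exact hnhds (mem_of_superset (Icc_mem_nhds haβ hbβ) (hI.out ha hb))
  have hsq : ∀ δ : ℝ, AnalyticAt ℝ (fun δ : ℝ => δ ^ 2) δ := fun δ => analyticAt_id.pow 2
  rcases hside with hside | hside
  -- The fold lands on the correct side of the endpoint for either sign of `δ`, and the square root
  -- is a continuous section; the second point `x` leaves room inside `I`.
  · refine ⟨{δ | δ ^ 2 < x - β}, fun δ => β + δ ^ 2, fun ε => Real.sqrt (ε - β),
      isOpen_lt (by fun_prop) continuous_const, ?_, fun δ => analyticAt_const.add (hsq δ), ?_,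
      by simp, by fun_prop, by simp, fun ε hε => ?_⟩
    · have := (hside x hx).lt_of_ne hne.symm
      simpa using this
    · intro δ hδ
      have hδ' : δ ^ 2 < x - β := hδ
      exact hI.out hβ hx ⟨by nlinarith [sq_nonneg δ], by linarith⟩
    · simp only
      rw [Real.sq_sqrt (sub_nonneg.2 (hside ε hε))]
      ring
  · refine ⟨{δ | δ ^ 2 < β - x}, fun δ => β - δ ^ 2, fun ε => Real.sqrt (β - ε),
      isOpen_lt (by fun_prop) continuous_const, ?_, fun δ => analyticAt_const.sub (hsq δ), ?_,
      by simp, by fun_prop, by simp, fun ε hε => ?_⟩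
    · have := (hside x hx).lt_of_ne hne
      simpa using this
    · intro δ hδ
      have hδ' : δ ^ 2 < β - x := hδ
      exact hI.out hx hβ ⟨by linarith, by nlinarith [sq_nonneg δ]⟩
    · simp only
      rw [Real.sq_sqrt (sub_nonneg.2 (hside ε hε))]
      ring

/-- The section `s` carries the accumulation to `0` in the chart, avoiding `0` itself because `e (s
ε) = ε ≠ β`; local persistence is then read back through `s`. -/
lemma eventually_nhdsWithin_of_accPt (hI : I.OrdConnected) (hΩ : IsAnalyticFamily I Ω γ)
    (hn : 0 < n) (hm : 0 < m) {β : ℝ} (hβ : β ∈ I)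
    (hacc : AccPt β (𝓟 {ε ∈ I | HasPeriodicInvariantCurve (γ ε) m n})) :
    ∀ᶠ ε in 𝓝[I] β, HasPeriodicInvariantCurve (γ ε) m n := by
  rw [accPt_iff_frequently] at hacc
  obtain ⟨x, hne, hx, -⟩ := hacc.exists
  obtain ⟨J, e, s, hJ, h0, he, heI, he0, hs, hs0, hes⟩ := exists_analytic_chart hI hβ hx hne
  have hs' : Tendsto s (𝓝 β) (𝓝 0) := hs0 ▸ hs
  have hloc := eventually_hasPeriodicInvariantCurve (hΩ.isOvalFamily_comp hJ he heI) h0 hn hm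
    (by
      rw [frequently_nhdsWithin_iff]
      refine hs'.frequently (hacc.mono fun ε hε => ⟨?_, fun h => hε.1 ?_⟩)
      · rw [hes ε hε.2.1]
        exact hε.2.2
      · have h' : s ε = 0 := h
        rw [← hes ε hε.2.1, h', he0])
  filter_upwards [nhdsWithin_le_nhds (hs'.eventually hloc), self_mem_nhdsWithin] with ε h1 hε
  rwa [hes ε hε] at h1

/-- The relative interior `A` of the resonant set is closed in `I`: a point of its closure outside
`A` would be an accumulation point of resonant parameters, hence in `A`. Connectedness of `I`
concludes. -/
lemma eq_of_accPt (hI : I.OrdConnected) (hΩ : IsAnalyticFamily I Ω γ)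
    (hn : 0 < n) (hm : 0 < m) {β : ℝ} (hβ : β ∈ I)
    (hacc : AccPt β (𝓟 {ε ∈ I | HasPeriodicInvariantCurve (γ ε) m n})) :
    {ε ∈ I | HasPeriodicInvariantCurve (γ ε) m n} = I := by
  have : PreconnectedSpace I := isPreconnected_iff_preconnectedSpace.1 hI.isPreconnected
  set A : Set I := {x | ∀ᶠ y : I in 𝓝 x, HasPeriodicInvariantCurve (γ y) m n}
  have hA : ∀ x : I, AccPt (x : ℝ) (𝓟 {ε ∈ I | HasPeriodicInvariantCurve (γ ε) m n}) →
      x ∈ A := fun x hx => by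
    have hval : Tendsto ((↑) : I → ℝ) (𝓝 x) (𝓝[I] x) :=
      tendsto_nhdsWithin_iff.2 ⟨continuousAt_subtype_val, Eventually.of_forall fun y => y.2⟩
    exact hval.eventually (eventually_nhdsWithin_of_accPt hI hΩ hn hm x.2 hx)
  have hopen : IsOpen A := isOpen_iff_mem_nhds.2 fun x hx => eventually_eventually_nhds.2 hx
  have hclosed : IsClosed A := by
    refine isClosed_of_closure_subset fun x hx => ?_
    by_contra hxA
    refine hxA (hA x ?_)
    rw [accPt_iff_frequently]
    refine continuousAt_subtype_val.tendsto.frequently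
      ((mem_closure_iff_frequently.1 hx).mono fun y hy => ⟨fun h => ?_, y.2, hy.self_of_nhds⟩)
    rw [Subtype.ext h] at hy
    exact hxA hy
  have huniv := IsClopen.eq_univ ⟨hclosed, hopen⟩ ⟨⟨β, hβ⟩, hA ⟨β, hβ⟩ hacc⟩
  refine Subset.antisymm (sep_subset _ _) fun ε hε => ⟨hε, ?_⟩
  have : (⟨ε, hε⟩ : I) ∈ A := huniv ▸ mem_univ _
  exact this.self_of_nhds

end Interval

end SymplecticBilliard

theorem theorem20 (I : Set ℝ) (hI : I.OrdConnected)
    (Ω : ℝ → Set SymplecticBilliard.Plane) (γ : ℝ → ℝ → SymplecticBilliard.Plane)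
    (hΩ : SymplecticBilliard.IsAnalyticFamily I Ω γ)
    (m : ℤ) (n : ℕ) (hn : 0 < n) (hmn : IsCoprime m (n : ℤ))
    (hpos : 0 < (m : ℝ) / (n : ℝ)) (hlt : (m : ℝ) / (n : ℝ) < 1) :
    ((∀ β ∈ I, ¬ AccPt β (𝓟 {ε ∈ I | SymplecticBilliard.HasPeriodicInvariantCurve (γ ε) m n})) ∨
      {ε ∈ I | SymplecticBilliard.HasPeriodicInvariantCurve (γ ε) m n} = I) ∧
    (IsCompact I →
      {ε ∈ I | SymplecticBilliard.HasPeriodicInvariantCurve (γ ε) m n}.Finite ∨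
      {ε ∈ I | SymplecticBilliard.HasPeriodicInvariantCurve (γ ε) m n} = I) := by
  have hn' : (0 : ℝ) < n := by exact_mod_cast hn
  have hm : 0 < m := by
    have : (0 : ℝ) < m := by
      have := mul_pos hpos hn'
      rwa [div_mul_cancel₀ _ hn'.ne'] at this
    exact_mod_cast this
  refine ⟨?_, fun hcomp => ?_⟩
  · by_cases hacc : ∃ β ∈ I, AccPt β
        (𝓟 {ε ∈ I | SymplecticBilliard.HasPeriodicInvariantCurve (γ ε) m n})
    · obtain ⟨β, hβ, hacc⟩ := hacc
      exact Or.inr (SymplecticBilliard.eq_of_accPt hI hΩ hn hm hβ hacc)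
    · push Not at hacc
      exact Or.inl hacc
  · by_cases hfin : {ε ∈ I | SymplecticBilliard.HasPeriodicInvariantCurve (γ ε) m n}.Finite
    · exact Or.inl hfin
    · obtain ⟨β, hβ, hacc⟩ := Set.Infinite.exists_accPt_of_subset_isCompact hfin hcomp
        (sep_subset _ _)
      exact Or.inr (SymplecticBilliard.eq_of_accPt hI hΩ hn hm hβ hacc)
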